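/- **Setting.** Let $\mathcal D$ be a square torus of side $a>0$ with its Euclidean (quotient) distance $\|x-y\|$, let $K\ge 1$, and let $\mathcal P(K)$ be the set of non-empty subsets of $\{1,\dots,K\}$ (the classes). Let $(p_C)_{C\in\mathcal P(K)}$ be a probability distribution on $\mathcal P(K)$, $L_C>0$ for every $C$ (mean file sizes), $\mathcal N_0>0$, $r\ge 0$, and let $\ell:[0,\infty)\to[0,\infty)$ be non-increasing with $\ell(0)=1$. A user is a triple $u=(x_u,y_u,C_u)$ (receiver, transmitter, class). For a finite configuration (finite counting measure) $\xi$ of users and $u\in\xi$, put $$I(u,\xi)=\sum_{v\in\xi\setminus\{u\}}|C_u\cap C_v|\,\ell(\|x_u-y_v\|),\qquad R(u,\xi)=\frac{|C_u|\,\ell(r)}{\mathcal N_0+I(u,\xi)}.$$ For $\lambda>0$, the spatial birth-and-death (SBD) process $\Phi_t$ is the Markov jump process on finite configurations in which users of class $C$ arrive as a Poisson rain of intensity $\lambda p_C$ per unit area and unit time for the transmitters, the receiver being obtained from the transmitter by a displacement of length $r$ in an independent uniform direction, and in which each present user $u$ leaves at rate $R(u,\Phi_t)/L_{C_u}$. For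 a Markov jump process with potential kernel $U(x,B)=\mathbb E_x\int_0^\infty \mathbf 1\{\Phi_t\in B\}\,dt$, an irreducibility measure is a non-zero $\sigma$-finite measure $\varphi$ such that $\varphi(B)>0$ implies $U(x,B)>0$ for all $x$. The process is *recurrent* if an irreducibility measure exists and $U(x,B)=\infty$ for all $x$ and all measurable $B$ charged by some irreducibility measure; a recurrent process is *positive recurrent* if it has an invariant probability measure and *null recurrent* otherwise. It is *transient* if the state space is a countable union of measurable sets $A_i$ with $\sup_{x\in A_i}U(x,A_i)<\infty$. The SBD process is *stable* if it is positive recurrent, and *unstable* if it is null recurrent or transient. **Theorem.** Let, in $[0,\infty]$ (with $\sup\emptyset=0$ and $\inf\emptyset=\infty$), $$\lambda_c^-=\sup\{\lambda>0:\Phi_t\text{ is stable for the intensity }\lambda\},\qquad \lambda_c^+=\inf\{\lambda>0:\Phi_t\text{ is unstable for the intensity }\lambda\}.$$ Then $0\le\lambda_c^-\le\lambda_c^+$; for every $\lambda>0$ with $\lambda<\lambda_c^-$ the process $\Phi_t$ is stable; and for every $\lambda>0$ with $\lambda>\lambda_c^+$ the process $\Phi_t$ is unstable. -/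

import Mathlib

open MeasureTheory
open scoped ENNReal NNReal

noncomputable section

/-! ## Markov jump processes and their recurrence properties -/

namespace JumpProcess

variable {X : Type*} [MeasurableSpace X]

/-- For a Markov jump process with (finite) rate measures `Q x` (`Q x B` is the rate of jumps from
`x` into `B`), `nJumpProb Q n t x B` is the probability, starting from `x`, that exactly `n` jumps
occur during `[0, t]` and that the state at time `t` is in `B`. The holding time in `x` is
exponential with parameter `Q x univ` and the jump goes to a point chosen according to
`Q x / Q x univ`. -/
def nJumpProb (Q : X → Measure X) : ℕ → ℝ → X → Set X → ℝ≥0∞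
  | 0, t, x, B => ENNReal.ofReal (Real.exp (-((Q x Set.univ).toReal * t))) * B.indicator 1 x
  | n + 1, t, x, B =>
      ∫⁻ s in Set.Ioc (0 : ℝ) t, ENNReal.ofReal (Real.exp (-((Q x Set.univ).toReal * s))) *
        ∫⁻ y, nJumpProb Q n (t - s) y B ∂(Q x)

/-- Transition function of the jump process: `transProb Q t x B` is the probability that the
process started at `x` is in `B` at time `t`. -/
def transProb (Q : X → Measure X) (t : ℝ) (x : X) (B : Set X) : ℝ≥0∞ :=
  ∑' n : ℕ, nJumpProb Q n t x B

/-- Expected total time spent in `B` by the process started at `x`. -/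
def potential (Q : X → Measure X) (x : X) (B : Set X) : ℝ≥0∞ :=
  ∫⁻ t in Set.Ioi (0 : ℝ), transProb Q t x B

/-- `φ` is an irreducibility measure: nonzero, σ-finite, and every measurable set charged by `φ`
is reached with positive probability from every state. -/
def IsIrreducibilityMeasure (Q : X → Measure X) (φ : Measure X) : Prop :=
  SigmaFinite φ ∧ φ ≠ 0 ∧
    ∀ B : Set X, MeasurableSet B → φ B ≠ 0 → ∀ x : X, 0 < potential Q x B

/-- `φ`-irreducibility for some `φ`. -/
def Irreducible (Q : X → Measure X) : Prop :=
  ∃ φ : Measure X, IsIrreducibilityMeasure Q φ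

/-- Recurrence: the process is irreducible and the expected time spent in `B` is infinite from
every starting state, for every `B` charged by an irreducibility measure (equivalently, by a
maximal irreducibility measure, since that one dominates all the others). -/
def Recurrent (Q : X → Measure X) : Prop :=
  Irreducible Q ∧ ∀ φ : Measure X, IsIrreducibilityMeasure Q φ →
    ∀ B : Set X, MeasurableSet B → φ B ≠ 0 → ∀ x : X, potential Q x B = ∞

/-- Transience: the state space is a countable union of uniformly transient sets. -/
def Transient (Q : X → Measure X) : Prop :=
  ∃ A : ℕ → Set X, (∀ i, MeasurableSet (A i)) ∧ (⋃ i, A i) = Set.univ ∧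
    ∀ i, ∃ c : ℝ≥0, ∀ x ∈ A i, potential Q x (A i) ≤ c

/-- `π` is an invariant (stationary) probability measure. -/
def IsInvariantProb (Q : X → Measure X) (π : Measure X) : Prop :=
  IsProbabilityMeasure π ∧
    ∀ t : ℝ, 0 ≤ t → ∀ B : Set X, MeasurableSet B → ∫⁻ x, transProb Q t x B ∂π = π B

def PositiveRecurrent (Q : X → Measure X) : Prop :=
  Recurrent Q ∧ ∃ π : Measure X, IsInvariantProb Q π

def NullRecurrent (Q : X → Measure X) : Prop :=
  Recurrent Q ∧ ¬ ∃ π : Measure X, IsInvariantProb Q π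

end JumpProcess

/-! ## The wireless network -/

/-- Classes of users: nonempty sets of bands. -/
def BandClass (K : ℕ) : Type := {C : Finset (Fin K) // C.Nonempty}

instance (K : ℕ) : Fintype (BandClass K) :=
  inferInstanceAs (Fintype {C : Finset (Fin K) // C.Nonempty})

instance (K : ℕ) : MeasurableSpace (BandClass K) := ⊤

/-- The square torus of side `a`. -/
abbrev SquareTorus (a : ℝ) : Type := AddCircle a × AddCircle a

/-- Euclidean distance on the square torus (not the sup distance of the product type). -/
def torusDist {a : ℝ} (x y : SquareTorus a) : ℝ :=
  Real.sqrt (‖x.1 - y.1‖ ^ 2 + ‖x.2 - y.2‖ ^ 2)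

/-- A user: location of the receiver, location of the transmitter, class. -/
abbrev User (a : ℝ) (K : ℕ) : Type := SquareTorus a × SquareTorus a × BandClass K

/-- Finite counting measures on the set of users, i.e. finite configurations of users, with
multiplicities. -/
def Config (a : ℝ) (K : ℕ) : Type := Multiset (User a K)

/-- The configuration formed by an `n`-tuple of users. -/
def Config.ofTuple {a : ℝ} {K : ℕ} (v : Σ n : ℕ, (Fin n → User a K)) : Config a K :=
  (List.ofFn v.2 : Multiset (User a K))

/-- The σ-algebra on finite configurations: a set of configurations is measurable when, for each
`n`, the set of `n`-tuples of users representing its elements is measurable. -/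
instance (a : ℝ) (K : ℕ) : MeasurableSpace (Config a K) :=
  MeasurableSpace.map Config.ofTuple inferInstance

/-- Configuration obtained when the user `u` arrives. -/
def Config.add {a : ℝ} {K : ℕ} (ξ : Config a K) (u : User a K) : Config a K :=
  Multiset.cons u ξ

open scoped Classical in
/-- Configuration obtained when (one copy of) the user `u` leaves. -/
def Config.remove {a : ℝ} {K : ℕ} (ξ : Config a K) (u : User a K) : Config a K :=
  Multiset.erase (α := User a K) ξ u

/-- Sum over the users of a configuration, with multiplicities. -/
def Config.sum {a : ℝ} {K : ℕ} {M : Type*} [AddCommMonoid M] (ξ : Config a K)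
    (f : User a K → M) : M :=
  (Multiset.map f ξ).sum

/-- Arrivals are measurable operations on configurations, so that the image measure used for the
birth rates below is the genuine one. -/
theorem Config.measurable_add {a : ℝ} {K : ℕ} (ξ : Config a K) :
    Measurable (fun u : User a K => ξ.add u) := by
  obtain ⟨l, rfl⟩ : ∃ l : List (User a K), (l : Multiset (User a K)) = ξ :=
    ⟨Quotient.out (s := List.isSetoid _) ξ, Quotient.out_eq (s := List.isSetoid _) ξ⟩
  intro B hB
  have hg : Measurable (fun u : User a K =>
      (⟨l.length + 1, Fin.cons u l.get⟩ : Σ n : ℕ, (Fin n → User a K))) := by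
    have h1 : Measurable (Sigma.mk (β := fun n : ℕ => (Fin n → User a K)) (l.length + 1)) := by
      exact Measurable.of_le_map (iInf_le (fun n : ℕ =>
        MeasurableSpace.map (Sigma.mk (β := fun n : ℕ => (Fin n → User a K)) n) inferInstance) _)
    refine h1.comp (measurable_pi_lambda _ fun i => ?_)
    refine Fin.cases ?_ (fun j => ?_) i
    · simpa using measurable_id'
    · simp
  have key := hg (show MeasurableSet (Config.ofTuple ⁻¹' B) from hB)
  convert key using 1
  ext u
  simp only [Set.mem_preimage, Config.ofTuple, Config.add]
  rw [List.ofFn_cons, List.ofFn_get]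
  rfl

/-- Parameters of the network, apart from the arrival intensity. The path-loss function is only
evaluated on `[0, ∞)`; being non-increasing with value `1` at `0` it is bounded there, and
integrable on the torus. No symmetry between the classes is assumed. -/
structure Network where
  /-- number of bands -/
  K : ℕ
  /-- side of the square torus -/
  side : ℝ
  side_pos : 0 < side
  /-- receiver-transmitter distance -/
  r : ℝ
  r_nonneg : 0 ≤ r
  /-- path-loss function -/
  pathLoss : ℝ → ℝ
  pathLoss_nonneg : ∀ s, 0 ≤ s → 0 ≤ pathLoss s
  pathLoss_antitone : AntitoneOn pathLoss (Set.Ici 0)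
  pathLoss_zero : pathLoss 0 = 1
  /-- thermal noise power -/
  noise : ℝ
  noise_pos : 0 < noise
  /-- distribution of the class of an arriving user -/
  p : BandClass K → ℝ
  p_nonneg : ∀ C, 0 ≤ p C
  p_sum : ∑ C, p C = 1
  /-- mean file size of the users of each class -/
  L : BandClass K → ℝ
  L_pos : ∀ C, 0 < L C

namespace Network

variable (N : Network)

instance : Fact (0 < N.side) := ⟨N.side_pos⟩

/-- Uniform probability measure on the set of directions `[0, 2π)`. -/
def directionLaw : Measure ℝ :=
  ProbabilityTheory.cond volume (Set.Ico 0 (2 * Real.pi))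

/-- The dipole of class `C` with transmitter at `y` and receiver at distance `r` from it in the
direction `θ`. -/
def dipole (C : BandClass N.K) (y : SquareTorus N.side) (θ : ℝ) : User N.side N.K :=
  (y + (((N.r * Real.cos θ : ℝ) : AddCircle N.side), ((N.r * Real.sin θ : ℝ) : AddCircle N.side)),
    y, C)

/-- Intensity measure of the arrivals for a unit spatial arrival intensity: transmitters
distributed as the area measure of the torus, independent uniform direction, independent class
with distribution `p`. -/
def arrivalMeasure : Measure (User N.side N.K) :=
  ∑ C : BandClass N.K, ENNReal.ofReal (N.p C) •
    (((volume : Measure (SquareTorus N.side)).prod directionLaw).map fun z => N.dipole C z.1 z.2)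

open scoped Classical in
/-- Number of bands common to two classes. -/
def overlap {K : ℕ} (C D : BandClass K) : ℕ := (C.1 ∩ D.1).card

/-- Interference at the receiver of the user `u` in the configuration `ξ`: sum over the
transmitters of the other users. -/
def interference (u : User N.side N.K) (ξ : Config N.side N.K) : ℝ :=
  (ξ.remove u).sum fun v => (overlap u.2.2 v.2.2 : ℝ) * N.pathLoss (torusDist u.1 v.2.1)

/-- Rate of transmission of the user `u` in the configuration `ξ`. -/
def rate (u : User N.side N.K) (ξ : Config N.side N.K) : ℝ :=
  (u.2.2.1.card : ℝ) * N.pathLoss N.r / (N.noise + N.interference u ξ)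

/-- Departure rate of the user `u` in the configuration `ξ`. -/
def deathRate (u : User N.side N.K) (ξ : Config N.side N.K) : ℝ :=
  N.rate u ξ / N.L u.2.2

/-- Jump rates of the spatial birth-and-death process with arrival intensity `lam`: users arrive
with intensity `lam` per unit of area and of time, and each user `u` present leaves with rate
`deathRate u ξ`. -/
def sbdRates (lam : ℝ≥0) (ξ : Config N.side N.K) : Measure (Config N.side N.K) :=
  (lam : ℝ≥0∞) • N.arrivalMeasure.map (fun u => ξ.add u) +
    ξ.sum fun u => ENNReal.ofReal (N.deathRate u ξ) • Measure.dirac (ξ.remove u)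

/-- The process with arrival intensity `lam` is stable if it is positive recurrent. -/
def Stable (lam : ℝ≥0) : Prop :=
  JumpProcess.PositiveRecurrent (N.sbdRates lam)

/-- The process with arrival intensity `lam` is unstable if it is null recurrent or transient. -/
def Unstable (lam : ℝ≥0) : Prop :=
  JumpProcess.NullRecurrent (N.sbdRates lam) ∨ JumpProcess.Transient (N.sbdRates lam)

end Network

end

/-! Two facts carry the theorem: at each positive intensity exactly one of stability and instability
holds (`stable_or_unstable`, `Stable.not_unstable`), and stability passes to smaller positive
intensities (`stable_of_le`). The rest is order theory of the suprema and infima.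

Dichotomy. If ℓ(r) = 0 nobody ever leaves and the process is transient. Otherwise every user leaves
at a positive rate, so the empty configuration o is an atom accessible from everywhere, and
recurrence or transience is decided by whether the expected time spent at o is infinite
(`recurrent_of_atom`, `transient_of_atom`). These quantities are computed as Green operators of the
embedded jump chain, through Laplace transforms in time.

Monotonicity. Extra users only add interference and so slow down departures; hence the process of
intensity λ can be coupled to stay inside that of intensity λ + δ. The coupled process is not
constructed. Its jump rates are used in a maximum principle for resolvents (`coupling_step`,
`comparison`), which shows that the α-resolvent of the indicator of o for λ + δ, from any state, is
at most the one for λ started from o. Integrating against an invariant probability π for λ + δ gives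
π{o} ≤ α R_α(o, {o}) for every α > 0, where R_α is the resolvent for λ, and π{o} > 0 by
accessibility.

Letting α tend to 0 has two consequences for the process of intensity λ. The expected time at o is
infinite, hence recurrence; and the mean length of an excursion from o is finite. The occupation
measure of an excursion balances the jump rates. As these are unbounded, invariance also uses that
their integral is finite, which follows from the drift of the number of users (`drift_size`).
Normalizing gives an invariant probability (`positiveRecurrent_of_atom`). -/

noncomputable section

/-! ## Kernel operators, Green operators and first hitting of an atom -/

namespace JumpProcess

variable {X : Type*} [MeasurableSpace X]

/-- The operator on nonnegative functions associated with a family of measures. -/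
def kernelOp (κ : X → Measure X) (g : X → ℝ≥0∞) (x : X) : ℝ≥0∞ := ∫⁻ y, g y ∂κ x

/-- The sum of the iterates of a kernel operator. -/
def greenOp (κ : X → Measure X) (φ : X → ℝ≥0∞) (x : X) : ℝ≥0∞ :=
  ∑' n : ℕ, (kernelOp κ)^[n] φ x

/-- A family of measures with the mass at `o` removed. -/
def taboo (κ : X → Measure X) (o : X) (x : X) : Measure X := (κ x).restrict {o}ᶜ

/-! ### Algebra of Green operators and minimality among supersolutions. -/

section Basic

variable {κ : X → Measure X} {φ ψ g : X → ℝ≥0∞}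

theorem measurable_kernelOp (hκ : Measurable κ) (hg : Measurable g) : Measurable (kernelOp κ g) :=
  (Measure.measurable_lintegral hg).comp hκ

theorem measurable_kernelOp_iterate (hκ : Measurable κ) (hg : Measurable g) (n : ℕ) :
    Measurable ((kernelOp κ)^[n] g) := by
  induction n with
  | zero => exact hg
  | succ n ih => rw [Function.iterate_succ_apply']; exact measurable_kernelOp hκ ih

theorem measurable_greenOp (hκ : Measurable κ) (hg : Measurable g) : Measurable (greenOp κ g) :=
  Measurable.tsum fun n => measurable_kernelOp_iterate hκ hg n

theorem measurable_mass (hκ : Measurable κ) {B : Set X} (hB : MeasurableSet B) :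
    Measurable fun y => κ y B :=
  (Measure.measurable_coe hB).comp hκ

theorem measurable_taboo [MeasurableSingletonClass X] (hκ : Measurable κ) (o : X) :
    Measurable (taboo κ o) := by
  refine Measure.measurable_of_measurable_coe _ fun B hB => ?_
  simp only [taboo, Measure.restrict_apply hB]
  exact (Measure.measurable_coe (hB.inter (measurableSet_singleton o).compl)).comp hκ

theorem kernelOp_mono (κ : X → Measure X) (h : φ ≤ ψ) : kernelOp κ φ ≤ kernelOp κ ψ :=
  fun _ => lintegral_mono h

theorem kernelOp_iterate_mono (κ : X → Measure X) (h : φ ≤ ψ) (n : ℕ) :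
    (kernelOp κ)^[n] φ ≤ (kernelOp κ)^[n] ψ :=
  Monotone.iterate (fun _ _ h => kernelOp_mono κ h) n h

theorem greenOp_mono (κ : X → Measure X) (h : φ ≤ ψ) : greenOp κ φ ≤ greenOp κ ψ :=
  fun x => ENNReal.tsum_le_tsum fun n => kernelOp_iterate_mono κ h n x

theorem kernelOp_const_mul (κ : X → Measure X) (hg : Measurable g) (c : ℝ≥0∞) :
    kernelOp κ (fun x => c * g x) = fun x => c * kernelOp κ g x :=
  funext fun _ => lintegral_const_mul c hg

theorem kernelOp_iterate_const_mul (hκ : Measurable κ) (hg : Measurable g) (c : ℝ≥0∞) (n : ℕ) :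
    (kernelOp κ)^[n] (fun x => c * g x) = fun x => c * (kernelOp κ)^[n] g x := by
  induction n with
  | zero => rfl
  | succ n ih =>
    simp only [Function.iterate_succ_apply', ih]
    exact kernelOp_const_mul κ (measurable_kernelOp_iterate hκ hg n) c

theorem greenOp_const_mul (hκ : Measurable κ) (hg : Measurable g) (c : ℝ≥0∞) (x : X) :
    greenOp κ (fun x => c * g x) x = c * greenOp κ g x := by
  simp only [greenOp, kernelOp_iterate_const_mul hκ hg, ENNReal.tsum_mul_left]

theorem kernelOp_add (κ : X → Measure X) (hφ : Measurable φ) :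
    kernelOp κ (fun x => φ x + ψ x) = fun x => kernelOp κ φ x + kernelOp κ ψ x :=
  funext fun _ => lintegral_add_left hφ _

theorem kernelOp_iterate_add (hκ : Measurable κ) (hφ : Measurable φ) (n : ℕ) :
    (kernelOp κ)^[n] (fun x => φ x + ψ x) =
      fun x => (kernelOp κ)^[n] φ x + (kernelOp κ)^[n] ψ x := by
  induction n with
  | zero => rfl
  | succ n ih =>
    simp only [Function.iterate_succ_apply', ih]
    exact kernelOp_add κ (measurable_kernelOp_iterate hκ hφ n)

theorem greenOp_add (hκ : Measurable κ) (hφ : Measurable φ) (x : X) :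
    greenOp κ (fun x => φ x + ψ x) x = greenOp κ φ x + greenOp κ ψ x := by
  simp only [greenOp, kernelOp_iterate_add hκ hφ]
  exact ENNReal.tsum_add

theorem kernelOp_iterate_sum (hκ : Measurable κ) {f : ℕ → X → ℝ≥0∞} (hf : ∀ i, Measurable (f i))
    (n N : ℕ) (x : X) :
    (kernelOp κ)^[n] (fun x => ∑ i ∈ Finset.range N, f i x) x =
      ∑ i ∈ Finset.range N, (kernelOp κ)^[n] (f i) x := by
  induction N with
  | zero =>
    have : (fun _ : X => (0 : ℝ≥0∞)) = fun x => 0 * (0 : ℝ≥0∞) := by simp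
    simp only [Finset.range_zero, Finset.sum_empty]
    rw [this, kernelOp_iterate_const_mul hκ measurable_const]
    simp
  | succ N ih =>
    simp only [Finset.sum_range_succ]
    rw [kernelOp_iterate_add hκ (Finset.measurable_fun_sum _ fun i _ => hf i), ← ih]

/-- Partial sums of a Green operator satisfy the one-step recursion. -/
theorem sum_kernelOp_iterate_succ (hκ : Measurable κ) (hφ : Measurable φ) (N : ℕ) (x : X) :
    ∑ n ∈ Finset.range (N + 1), (kernelOp κ)^[n] φ x =
      φ x + kernelOp κ (fun y => ∑ n ∈ Finset.range N, (kernelOp κ)^[n] φ y) x := by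
  rw [Finset.sum_range_succ']
  simp only [Function.iterate_succ_apply', Function.iterate_zero, id]
  rw [add_comm, kernelOp, lintegral_finsetSum _ fun n _ => measurable_kernelOp_iterate hκ hφ n]
  rfl

theorem greenOp_eq (hκ : Measurable κ) (hφ : Measurable φ) (x : X) :
    greenOp κ φ x = φ x + kernelOp κ (greenOp κ φ) x := by
  simp only [greenOp, kernelOp]
  rw [lintegral_tsum fun n => (measurable_kernelOp_iterate hκ hφ n).aemeasurable,
    tsum_eq_zero_add' ENNReal.summable]
  simp only [Function.iterate_succ_apply']
  rfl

theorem sum_le_greenOp (κ : X → Measure X) (φ : X → ℝ≥0∞) (N : ℕ) (x : X) :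
    ∑ n ∈ Finset.range N, (kernelOp κ)^[n] φ x ≤ greenOp κ φ x :=
  ENNReal.sum_le_tsum _

theorem greenOp_le_of_sum_le {x : X} {c : ℝ≥0∞}
    (h : ∀ N, ∑ n ∈ Finset.range N, (kernelOp κ)^[n] φ x ≤ c) : greenOp κ φ x ≤ c := by
  rw [greenOp, ENNReal.tsum_eq_iSup_nat]
  exact iSup_le h

/-- The Green operator yields the smallest supersolution. -/
theorem greenOp_le (hκ : Measurable κ) (hφ : Measurable φ) (h : ∀ x, φ x + kernelOp κ g x ≤ g x)
    (x : X) : greenOp κ φ x ≤ g x := by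
  refine greenOp_le_of_sum_le fun N => ?_
  induction N generalizing x with
  | zero => simp
  | succ N ih =>
    rw [sum_kernelOp_iterate_succ hκ hφ]
    exact (add_le_add_right (kernelOp_mono κ ih x) _).trans (h x)

theorem le_greenOp (κ : X → Measure X) (φ : X → ℝ≥0∞) (x : X) : φ x ≤ greenOp κ φ x :=
  ENNReal.le_tsum (f := fun n => (kernelOp κ)^[n] φ x) 0

end Basic

/-! ### Visits and returns to an atom. -/

section Atom

variable {κ : X → Measure X} {o : X} [MeasurableSingletonClass X]

theorem kernelOp_eq_atom_add (κ : X → Measure X) (o : X) {g : X → ℝ≥0∞} (hg : Measurable g)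
    (x : X) : kernelOp κ g x = κ x {o} * g o + kernelOp (taboo κ o) g x := by
  rw [kernelOp, ← lintegral_add_compl g (measurableSet_singleton o), Measure.restrict_singleton,
    lintegral_smul_measure, lintegral_dirac' _ hg]
  rfl

/-- The probability of hitting `o` after at least one step. -/
def hitProb (κ : X → Measure X) (o x : X) : ℝ≥0∞ := greenOp (taboo κ o) (fun y => κ y {o}) x

theorem measurable_hitProb (hκ : Measurable κ) (o : X) : Measurable (hitProb κ o) :=
  measurable_greenOp (measurable_taboo hκ o) (measurable_mass hκ (measurableSet_singleton o))

theorem hitProb_eq (hκ : Measurable κ) (o x : X) :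
    hitProb κ o x = κ x {o} + kernelOp (taboo κ o) (hitProb κ o) x :=
  greenOp_eq (measurable_taboo hκ o) (measurable_mass hκ (measurableSet_singleton o)) x

theorem kernelOp_taboo_indicator (κ : X → Measure X) (o x : X) :
    kernelOp (taboo κ o) (({o} : Set X).indicator 1) x = 0 := by
  rw [kernelOp, lintegral_indicator_one (measurableSet_singleton o), taboo,
    Measure.restrict_apply (measurableSet_singleton o)]
  simp

/-- First passage decomposition of the expected number of visits to `o` before time `N`. -/
theorem sum_visits_le (hκ : Measurable κ) (o : X) (N : ℕ) (x : X) :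
    ∑ n ∈ Finset.range N, (kernelOp κ)^[n] (({o} : Set X).indicator 1) x ≤
      ({o} : Set X).indicator 1 x + hitProb κ o x *
        ∑ n ∈ Finset.range N, (kernelOp κ)^[n] (({o} : Set X).indicator 1) o := by
  have h1 : Measurable (({o} : Set X).indicator (1 : X → ℝ≥0∞)) :=
    measurable_one.indicator (measurableSet_singleton o)
  have hs : ∀ N, Measurable fun x =>
      ∑ n ∈ Finset.range N, (kernelOp κ)^[n] (({o} : Set X).indicator (1 : X → ℝ≥0∞)) x := fun N =>
    Finset.measurable_fun_sum _ fun n _ => measurable_kernelOp_iterate hκ h1 n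
  induction N generalizing x with
  | zero => simp
  | succ N ih =>
    set S : ℝ≥0∞ := ∑ n ∈ Finset.range N, (kernelOp κ)^[n] (({o} : Set X).indicator 1) o with hS
    have hSS : S ≤ ∑ n ∈ Finset.range (N + 1), (kernelOp κ)^[n] (({o} : Set X).indicator 1) o :=
      Finset.sum_le_sum_of_subset (Finset.range_mono (Nat.le_succ N))
    rw [sum_kernelOp_iterate_succ hκ h1, kernelOp_eq_atom_add κ o (hs N)]
    -- A step that avoids `o` is continued by the induction hypothesis; its indicator term vanishes
    -- because the taboo kernel gives no mass to `o`.
    have h2 : kernelOp (taboo κ o)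
        (fun y => ∑ n ∈ Finset.range N, (kernelOp κ)^[n] (({o} : Set X).indicator 1) y) x ≤
        S * kernelOp (taboo κ o) (hitProb κ o) x := by
      refine (kernelOp_mono _ (ψ := fun y => ({o} : Set X).indicator 1 y + S * hitProb κ o y)
        (fun y => ?_) x).trans ?_
      · exact (ih y).trans_eq (by rw [mul_comm])
      · rw [kernelOp_add _ h1, kernelOp_const_mul _ (measurable_hitProb hκ o)]
        beta_reduce
        rw [kernelOp_taboo_indicator, zero_add]
    calc _ ≤ ({o} : Set X).indicator 1 x + (κ x {o} * S +
          S * kernelOp (taboo κ o) (hitProb κ o) x) := by gcongr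
      _ = ({o} : Set X).indicator 1 x + hitProb κ o x * S := by
        rw [hitProb_eq hκ o x]; ring
      _ ≤ _ := by gcongr

theorem greenOp_visits_le (hκ : Measurable κ) (o x : X) :
    greenOp κ (({o} : Set X).indicator 1) x ≤
      1 + hitProb κ o x * greenOp κ (({o} : Set X).indicator 1) o := by
  refine greenOp_le_of_sum_le fun N => (sum_visits_le hκ o N x).trans ?_
  gcongr
  · exact Set.indicator_le_self' (fun _ _ => zero_le) x
  · exact sum_le_greenOp κ _ N o

/-- Conservation of mass until the first hitting of `o`. -/
theorem greenOp_taboo_add_hitProb_le (hκ : Measurable κ) (o : X) {φ : X → ℝ≥0∞}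
    (hφ : Measurable φ) (h : ∀ x, φ x + κ x Set.univ ≤ 1) (x : X) :
    greenOp (taboo κ o) φ x + hitProb κ o x ≤ 1 := by
  have ho := measurable_mass hκ (measurableSet_singleton o)
  rw [hitProb, ← greenOp_add (measurable_taboo hκ o) hφ]
  refine greenOp_le (g := fun _ => 1) (measurable_taboo hκ o) (hφ.add ho) (fun y => ?_) x
  refine le_trans (le_of_eq ?_) (h y)
  rw [kernelOp, lintegral_one, taboo, Measure.restrict_apply MeasurableSet.univ, Set.univ_inter,
    Pi.add_apply, add_assoc, measure_add_measure_compl (measurableSet_singleton o)]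

theorem hitProb_le_one (hκ : Measurable κ) (o : X) (h : ∀ x, κ x Set.univ ≤ 1) (x : X) :
    hitProb κ o x ≤ 1 :=
  le_add_self.trans (greenOp_taboo_add_hitProb_le hκ o (φ := fun _ => 0) measurable_const
    (by simpa using h) x)

/-- The discounted occupation until the return to `o` is at most the inverse of the expected
number of visits to `o`. -/
theorem greenOp_taboo_mul_visits_le_one (hκ : Measurable κ) (o : X) {φ : X → ℝ≥0∞}
    (hφ : Measurable φ) (h : ∀ x, φ x + κ x Set.univ ≤ 1)
    (hG : greenOp κ (({o} : Set X).indicator 1) o ≠ ∞) :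
    greenOp (taboo κ o) φ o * greenOp κ (({o} : Set X).indicator 1) o ≤ 1 := by
  set G := greenOp κ (({o} : Set X).indicator 1) o
  have h1 := greenOp_taboo_add_hitProb_le hκ o hφ h o
  have hH : hitProb κ o o ≤ 1 := le_add_self.trans h1
  -- The common term is finite because `G` is, so it cancels.
  have h2 : greenOp (taboo κ o) φ o * G + hitProb κ o o * G ≤ 1 + hitProb κ o o * G := by
    rw [← add_mul]
    calc _ ≤ 1 * G := by gcongr
      _ ≤ _ := by rw [one_mul]; exact greenOp_visits_le hκ o o
  refine (ENNReal.add_le_add_iff_right (ENNReal.mul_ne_top ?_ hG)).1 h2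
  exact (hH.trans_lt ENNReal.one_lt_top).ne

/-- With a return probability H < 1 the expected number of visits would be at most the geometric sum
(1 - H)⁻¹. The estimate is made on partial sums, which are finite and can be subtracted. -/
theorem hitProb_eq_one (hκ : Measurable κ) (o : X) (h : ∀ x, κ x Set.univ ≤ 1)
    (hG : greenOp κ (({o} : Set X).indicator 1) o = ∞) : hitProb κ o o = 1 := by
  refine le_antisymm (hitProb_le_one hκ o h o) ?_
  by_contra! hlt
  have h1 : Measurable (({o} : Set X).indicator (1 : X → ℝ≥0∞)) :=
    measurable_one.indicator (measurableSet_singleton o)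
  have hHt : hitProb κ o o ≠ ∞ := (hlt.trans ENNReal.one_lt_top).ne
  have hfin : ∀ n x, (kernelOp κ)^[n] (({o} : Set X).indicator (1 : X → ℝ≥0∞)) x ≤ 1 := by
    intro n
    induction n with
    | zero => exact fun x => Set.indicator_le_self' (fun _ _ => zero_le) x
    | succ n ih =>
      intro x
      rw [Function.iterate_succ_apply']
      refine (kernelOp_mono κ (ψ := fun _ => 1) ih x).trans ?_
      rw [kernelOp, lintegral_one]
      exact h x
  have : greenOp κ (({o} : Set X).indicator 1) o ≤ (1 - hitProb κ o o)⁻¹ := by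
    refine greenOp_le_of_sum_le fun N => ?_
    have hle := sum_visits_le hκ o N o
    set S := ∑ n ∈ Finset.range N, (kernelOp κ)^[n] (({o} : Set X).indicator (1 : X → ℝ≥0∞)) o
    have hS : S ≠ ∞ := (ENNReal.sum_lt_top.2 fun n _ =>
      (hfin n o).trans_lt ENNReal.one_lt_top).ne
    rw [ENNReal.le_inv_iff_mul_le, mul_comm, ENNReal.sub_mul (fun _ _ => hS), one_mul]
    refine tsub_le_iff_right.2 ?_
    simpa using hle
  rw [hG, top_le_iff, ENNReal.inv_eq_top, tsub_eq_zero_iff_le] at this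
  exact absurd hlt (not_lt.2 this)

end Atom

end JumpProcess

/-! ## Resolvents of jump processes -/

namespace JumpProcess

variable {X : Type*} [MeasurableSpace X]

/-- Measurable finite rates, bounded below by `q₀ > 0`. -/
structure RegularRates (Q : X → Measure X) (q₀ : ℝ≥0∞) : Prop where
  measurable : Measurable Q
  ne_top : ∀ x, Q x Set.univ ≠ ∞
  ne_zero : q₀ ≠ 0
  le : ∀ x, q₀ ≤ Q x Set.univ

/-- Transition kernel of the embedded chain killed at rate `α`. -/
def killedStep (Q : X → Measure X) (α : ℝ≥0) (x : X) : Measure X :=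
  ((α : ℝ≥0∞) + Q x Set.univ)⁻¹ • Q x

/-- The `α`-resolvent of the jump process, expressed through its embedded chain. -/
def resolvent (Q : X → Measure X) (α : ℝ≥0) (f : X → ℝ≥0∞) (x : X) : ℝ≥0∞ :=
  greenOp (killedStep Q α) (fun y => ((α : ℝ≥0∞) + Q y Set.univ)⁻¹ * f y) x

namespace RegularRates

variable {Q : X → Measure X} {q₀ : ℝ≥0∞} {f g : X → ℝ≥0∞}

theorem rate_ne_zero (h : RegularRates Q q₀) (x : X) : Q x Set.univ ≠ 0 :=
  fun h0 => h.ne_zero (le_zero_iff.1 (h0 ▸ h.le x))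

theorem isFiniteMeasure (h : RegularRates Q q₀) (x : X) : IsFiniteMeasure (Q x) :=
  ⟨(h.ne_top x).lt_top⟩

theorem measurable_rate (h : RegularRates Q q₀) : Measurable fun x => Q x Set.univ :=
  measurable_mass h.measurable MeasurableSet.univ

theorem add_ne_zero (h : RegularRates Q q₀) (α : ℝ≥0) (x : X) :
    (α : ℝ≥0∞) + Q x Set.univ ≠ 0 := by
  simp [h.rate_ne_zero x]

theorem add_ne_top (h : RegularRates Q q₀) (α : ℝ≥0) (x : X) :
    (α : ℝ≥0∞) + Q x Set.univ ≠ ∞ :=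
  ENNReal.add_ne_top.2 ⟨ENNReal.coe_ne_top, h.ne_top x⟩

theorem measurable_inv (h : RegularRates Q q₀) (α : ℝ≥0) :
    Measurable fun x => ((α : ℝ≥0∞) + Q x Set.univ)⁻¹ :=
  (measurable_const.add h.measurable_rate).inv

theorem measurable_inv_mul (h : RegularRates Q q₀) (α : ℝ≥0) (hf : Measurable f) :
    Measurable fun x => ((α : ℝ≥0∞) + Q x Set.univ)⁻¹ * f x :=
  (h.measurable_inv α).mul hf

theorem measurable_killedStep (h : RegularRates Q q₀) (α : ℝ≥0) :
    Measurable (killedStep Q α) := by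
  refine Measure.measurable_of_measurable_coe _ fun B hB => ?_
  simp only [killedStep, Measure.smul_apply, smul_eq_mul]
  exact (h.measurable_inv α).mul (measurable_mass h.measurable hB)

theorem kernelOp_killedStep (Q : X → Measure X) (α : ℝ≥0) (g : X → ℝ≥0∞) (x : X) :
    kernelOp (killedStep Q α) g x = ((α : ℝ≥0∞) + Q x Set.univ)⁻¹ * kernelOp Q g x := by
  rw [kernelOp, killedStep, lintegral_smul_measure]
  rfl

/-- At each step the killing and jump probabilities add up to one, so α times a discounted
occupation time is a killing probability. -/
theorem killedStep_univ_le (h : RegularRates Q q₀) (α : ℝ≥0) (x : X) :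
    ((α : ℝ≥0∞) + Q x Set.univ)⁻¹ * α + killedStep Q α x Set.univ = 1 := by
  rw [killedStep, Measure.smul_apply, smul_eq_mul, ← mul_add,
    ENNReal.inv_mul_cancel (h.add_ne_zero α x) (h.add_ne_top α x)]

theorem killedStep_univ_le_one (h : RegularRates Q q₀) (α : ℝ≥0) (x : X) :
    killedStep Q α x Set.univ ≤ 1 :=
  le_add_self.trans (h.killedStep_univ_le α x).le

theorem measurable_resolvent (h : RegularRates Q q₀) (α : ℝ≥0) (hf : Measurable f) :
    Measurable (resolvent Q α f) :=
  measurable_greenOp (h.measurable_killedStep α) (h.measurable_inv_mul α hf)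

/-- The resolvent equation. -/
theorem resolvent_eq (h : RegularRates Q q₀) (α : ℝ≥0) (hf : Measurable f) (x : X) :
    ((α : ℝ≥0∞) + Q x Set.univ) * resolvent Q α f x = f x + kernelOp Q (resolvent Q α f) x := by
  rw [resolvent, greenOp_eq (h.measurable_killedStep α) (h.measurable_inv_mul α hf),
    kernelOp_killedStep, ← mul_add, ← mul_assoc,
    ENNReal.mul_inv_cancel (h.add_ne_zero α x) (h.add_ne_top α x), one_mul]
  rfl

/-- The constant α⁻¹ is a supersolution of the resolvent equation. -/
theorem resolvent_le (h : RegularRates Q q₀) {α : ℝ≥0} (hα : 0 < α) (hf : Measurable f)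
    (hf1 : ∀ x, f x ≤ 1) (x : X) : resolvent Q α f x ≤ (α : ℝ≥0∞)⁻¹ := by
  refine greenOp_le (g := fun _ => (α : ℝ≥0∞)⁻¹) (h.measurable_killedStep α)
    (h.measurable_inv_mul α hf) (fun y => ?_) x
  have hα0 : (α : ℝ≥0∞) ≠ 0 := by simpa using hα.ne'
  rw [kernelOp_killedStep, ← mul_add, kernelOp, lintegral_const,
    ← ENNReal.div_eq_inv_mul]
  refine ENNReal.div_le_of_le_mul ?_
  rw [mul_add, ENNReal.inv_mul_cancel hα0 ENNReal.coe_ne_top]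
  gcongr
  exact hf1 y

theorem resolvent_anti (α : ℝ≥0) (f : X → ℝ≥0∞) (x : X) :
    resolvent Q α f x ≤ resolvent Q 0 f x := by
  have hle : ∀ y, ((α : ℝ≥0∞) + Q y Set.univ)⁻¹ ≤ (((0 : ℝ≥0) : ℝ≥0∞) + Q y Set.univ)⁻¹ :=
    fun y => by gcongr; exact zero_le
  have key : ∀ n, (kernelOp (killedStep Q α))^[n]
      (fun y => ((α : ℝ≥0∞) + Q y Set.univ)⁻¹ * f y) ≤
      (kernelOp (killedStep Q 0))^[n]
      (fun y => (((0 : ℝ≥0) : ℝ≥0∞) + Q y Set.univ)⁻¹ * f y) := by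
    intro n
    induction n with
    | zero => exact fun y => mul_le_mul_left (hle y) _
    | succ n ih =>
      intro y
      simp only [Function.iterate_succ_apply', kernelOp_killedStep]
      exact mul_le_mul' (hle y) (kernelOp_mono Q ih y)
  exact ENNReal.tsum_le_tsum fun n => key n x

/-- Integrals against the rates depend measurably on parameters. -/
theorem measurable_lintegral_joint (h : RegularRates Q q₀) {T : Type*} [MeasurableSpace T]
    {F : T → X → ℝ≥0∞} (hF : Measurable (Function.uncurry F)) :
    Measurable fun p : T × X => ∫⁻ y, F p.1 y ∂Q p.2 := by
  -- The total rates may be unbounded, so the measurability theorem is applied to the normalized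
  -- kernel and the total rate is multiplied back afterwards.
  let κ : ProbabilityTheory.Kernel X X := ⟨killedStep Q 0, h.measurable_killedStep 0⟩
  have hκ : ProbabilityTheory.IsFiniteKernel κ :=
    ⟨⟨1, ENNReal.one_lt_top, fun x => h.killedStep_univ_le_one 0 x⟩⟩
  have h1 : Measurable fun p : T × X => ∫⁻ y, F p.1 y ∂(κ.comap Prod.snd measurable_snd) p :=
    Measurable.lintegral_kernel_prod_right (f := fun (p : T × X) y => F p.1 y)
      (hF.comp ((measurable_fst.comp measurable_fst).prodMk measurable_snd))
  convert (h.measurable_rate.comp measurable_snd).mul h1 using 1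
  funext p
  symm
  change Q p.2 Set.univ * kernelOp (killedStep Q 0) (F p.1) p.2 = _
  rw [kernelOp_killedStep, ← mul_assoc, ENNReal.coe_zero, zero_add,
    ENNReal.mul_inv_cancel (h.rate_ne_zero _) (h.ne_top _), one_mul]
  rfl

end RegularRates

/-- The survival probability at time `s` of an exponential clock of rate `c`. -/
def expDecay (c s : ℝ) : ℝ≥0∞ := ENNReal.ofReal (Real.exp (-(c * s)))

theorem measurable_expDecay : Measurable (Function.uncurry expDecay) := by
  unfold expDecay Function.uncurry
  fun_prop

theorem measurable_expDecay_right (c : ℝ) : Measurable (expDecay c) := by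
  unfold expDecay
  fun_prop

theorem lintegral_expDecay {c : ℝ} (hc : 0 < c) :
    ∫⁻ s in Set.Ioi (0 : ℝ), expDecay c s = (ENNReal.ofReal c)⁻¹ := by
  have h := integral_exp_mul_Ioi (neg_lt_zero.2 hc) 0
  have hi := integrableOn_exp_mul_Ioi (neg_lt_zero.2 hc) 0
  simp only [expDecay, ← neg_mul]
  rw [← ofReal_integral_eq_lintegral_ofReal hi (Filter.Eventually.of_forall fun _ => by positivity),
    h, ← ENNReal.ofReal_inv_of_pos hc]
  congr 1
  simp [neg_div, div_neg]

/-- The clock has either rung by time t or not. Used as a way of rewriting 1, it avoids subtraction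
in `ℝ≥0∞`. -/
theorem lintegral_Ioc_expDecay {c t : ℝ} (hc : 0 ≤ c) (ht : 0 ≤ t) :
    ENNReal.ofReal c * (∫⁻ s in Set.Ioc (0 : ℝ) t, expDecay c s) + expDecay c t = 1 := by
  have hcont : Continuous fun s => c * Real.exp (-(c * s)) := by fun_prop
  have hint : ∫ s in (0 : ℝ)..t, c * Real.exp (-(c * s)) = 1 - Real.exp (-(c * t)) := by
    have hd : ∀ s ∈ Set.uIcc 0 t, HasDerivAt (fun s => -Real.exp (-(c * s)))
        (c * Real.exp (-(c * s))) s := fun s _ => by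
      have h1 : HasDerivAt (fun s => -(c * s)) (-c) s := by
        exact (((hasDerivAt_id s).const_mul c).neg).congr_deriv (by rw [mul_one])
      exact (h1.exp.neg).congr_deriv (by ring)
    rw [intervalIntegral.integral_eq_sub_of_hasDerivAt hd (hcont.intervalIntegrable 0 t)]
    simp
    ring
  have h1 : ENNReal.ofReal c * (∫⁻ s in Set.Ioc (0 : ℝ) t, expDecay c s) =
      ENNReal.ofReal (1 - Real.exp (-(c * t))) := by
    rw [← lintegral_const_mul _ (measurable_expDecay_right c), ← hint,
      intervalIntegral.integral_of_le ht, ofReal_integral_eq_lintegral_ofReal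
        (hcont.integrableOn_Ioc) (Filter.Eventually.of_forall fun s => by positivity)]
    simp only [expDecay, ENNReal.ofReal_mul hc]
  rw [h1, expDecay, ← ENNReal.ofReal_add _ (Real.exp_pos _).le]
  · simp
  · have : Real.exp (-(c * t)) ≤ 1 := Real.exp_le_one_iff.2 (by nlinarith [mul_nonneg hc ht])
    linarith

/-- The integral over `(0, ∞)` of a convolution is the product of the integrals. -/
theorem lintegral_convolution {F G : ℝ → ℝ≥0∞} (hF : Measurable F) (hG : Measurable G) :
    ∫⁻ t in Set.Ioi (0 : ℝ), ∫⁻ s in Set.Ioc (0 : ℝ) t, F s * G (t - s) =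
      (∫⁻ s in Set.Ioi (0 : ℝ), F s) * ∫⁻ t in Set.Ioi (0 : ℝ), G t := by
  have h1 : ∀ t ∈ Set.Ioi (0 : ℝ), ∫⁻ s in Set.Ioc (0 : ℝ) t, F s * G (t - s) =
      ∫⁻ s in Set.Ioi (0 : ℝ), F s * (Set.Ici (0 : ℝ)).indicator G (t - s) := by
    intro t _
    rw [← lintegral_indicator measurableSet_Ioc, ← lintegral_indicator measurableSet_Ioi]
    refine lintegral_congr fun s => ?_
    by_cases h0 : 0 < s <;> by_cases h2 : s ≤ t <;> simp [Set.indicator, h0, h2]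
  have hG' : Measurable ((Set.Ici (0 : ℝ)).indicator G) := hG.indicator measurableSet_Ici
  rw [setLIntegral_congr_fun measurableSet_Ioi h1, lintegral_lintegral_swap]
  · rw [← lintegral_mul_const _ hF]
    refine setLIntegral_congr_fun measurableSet_Ioi fun s (hs : 0 < s) => ?_
    rw [lintegral_const_mul _ (by exact hG'.comp (measurable_id.sub_const s))]
    congr 1
    have h3 : ∀ t, (Set.Ioi (0 : ℝ)).indicator (fun t => (Set.Ici (0 : ℝ)).indicator G (t - s)) t =
        (Set.Ici (0 : ℝ)).indicator G (t - s) := by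
      intro t
      by_cases ht : 0 < t
      · simp [ht]
      · have : ¬ s ≤ t := fun h => ht (hs.trans_le h)
        simp [ht, this]
    rw [← lintegral_indicator measurableSet_Ioi]
    simp_rw [h3]
    rw [lintegral_sub_right_eq_self ((Set.Ici (0 : ℝ)).indicator G),
      lintegral_indicator measurableSet_Ici, setLIntegral_congr Ioi_ae_eq_Ici]
  · exact ((hF.comp measurable_snd).mul
      (hG'.comp (measurable_fst.sub measurable_snd))).aemeasurable

/-! ### Laplace transforms of the transition function. -/

namespace RegularRates

variable {Q : X → Measure X} {q₀ : ℝ≥0∞} {f g : X → ℝ≥0∞} {B : Set X}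

theorem measurable_nJumpProb (h : RegularRates Q q₀) (hB : MeasurableSet B) (n : ℕ) :
    Measurable fun p : ℝ × X => nJumpProb Q n p.1 p.2 B := by
  have hq : Measurable fun x => (Q x Set.univ).toReal := h.measurable_rate.ennreal_toReal
  induction n with
  | zero =>
    simp only [nJumpProb]
    have : Measurable fun p : ℝ × X => B.indicator (1 : X → ℝ≥0∞) p.2 :=
      (measurable_one.indicator hB).comp measurable_snd
    refine Measurable.mul ?_ this
    exact measurable_expDecay.comp ((hq.comp measurable_snd).prodMk measurable_fst)
  | succ n ih =>
    have hI : Measurable fun p : ℝ × X => ∫⁻ y, nJumpProb Q n p.1 y B ∂Q p.2 :=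
      h.measurable_lintegral_joint (F := fun t y => nJumpProb Q n t y B) ih
    have hm : MeasurableSet {z : (ℝ × X) × ℝ | z.2 ∈ Set.Ioc 0 z.1.1} :=
      (measurableSet_lt measurable_const measurable_snd).inter
        (measurableSet_le measurable_snd (measurable_fst.comp measurable_fst))
    have hF : Measurable fun z : (ℝ × X) × ℝ => expDecay (Q z.1.2 Set.univ).toReal z.2 *
        ∫⁻ y, nJumpProb Q n (z.1.1 - z.2) y B ∂Q z.1.2 := by
      refine Measurable.mul ?_ ?_
      · exact measurable_expDecay.comp
          ((hq.comp (measurable_snd.comp measurable_fst)).prodMk measurable_snd)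
      · exact hI.comp (((measurable_fst.comp measurable_fst).sub measurable_snd).prodMk
          (measurable_snd.comp measurable_fst))
    convert Measurable.lintegral_prod_right' (ν := (volume : Measure ℝ))
      (hF.indicator hm) using 1
    funext p
    rw [nJumpProb, ← lintegral_indicator measurableSet_Ioc]
    rfl

/-- Laplace transform of the transition probabilities with a given number of jumps. -/
theorem laplace_nJumpProb (h : RegularRates Q q₀) (hB : MeasurableSet B) (α : ℝ≥0) (n : ℕ)
    (x : X) :
    ∫⁻ t in Set.Ioi (0 : ℝ), expDecay α t * nJumpProb Q n t x B =
      (kernelOp (killedStep Q α))^[n]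
        (fun y => ((α : ℝ≥0∞) + Q y Set.univ)⁻¹ * B.indicator 1 y) x := by
  have hqpos : ∀ x, 0 < (Q x Set.univ).toReal := fun x =>
    ENNReal.toReal_pos (h.rate_ne_zero x) (h.ne_top x)
  have hc : ∀ x, 0 < (α : ℝ) + (Q x Set.univ).toReal := fun x => by have := hqpos x; positivity
  have hofReal : ∀ x, ENNReal.ofReal ((α : ℝ) + (Q x Set.univ).toReal) =
      (α : ℝ≥0∞) + Q x Set.univ := fun x => by
    rw [ENNReal.ofReal_add α.coe_nonneg (hqpos x).le, ENNReal.ofReal_coe_nnreal,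
      ENNReal.ofReal_toReal (h.ne_top x)]
  have hmul : ∀ x s, expDecay α s * expDecay (Q x Set.univ).toReal s =
      expDecay ((α : ℝ) + (Q x Set.univ).toReal) s := fun x s => by
    rw [expDecay, expDecay, expDecay, ← ENNReal.ofReal_mul (by positivity), ← Real.exp_add]
    congr 2; ring
  induction n generalizing x with
  | zero =>
    simp only [nJumpProb, Function.iterate_zero, id]
    simp_rw [← mul_assoc]
    rw [lintegral_mul_const _ (by
      exact (measurable_expDecay_right _).mul (measurable_expDecay_right _)),
      ← hofReal, ← lintegral_expDecay (hc x)]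
    congr 2
    exact funext fun s => hmul x s
  | succ n ih =>
    have hN := h.measurable_nJumpProb hB n
    have := h.isFiniteMeasure x
    have hI : Measurable fun t : ℝ => ∫⁻ y, nJumpProb Q n t y B ∂Q x :=
      (h.measurable_lintegral_joint (F := fun t y => nJumpProb Q n t y B) hN).comp
        (measurable_id.prodMk measurable_const)
    rw [Function.iterate_succ_apply', kernelOp_killedStep, kernelOp, ← hofReal,
      ← lintegral_expDecay (hc x)]
    have h1 : ∫⁻ y, (kernelOp (killedStep Q α))^[n]
        (fun y => ((α : ℝ≥0∞) + Q y Set.univ)⁻¹ * B.indicator 1 y) y ∂Q x =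
        ∫⁻ t in Set.Ioi (0 : ℝ), expDecay α t * ∫⁻ y, nJumpProb Q n t y B ∂Q x := by
      simp_rw [← ih]
      rw [lintegral_lintegral_swap]
      · refine lintegral_congr fun t => ?_
        rw [lintegral_const_mul]
        exact hN.comp (measurable_const.prodMk measurable_id)
      · exact (((measurable_expDecay_right _).comp measurable_snd).mul
          (hN.comp measurable_swap)).aemeasurable
    have hG : Measurable fun t : ℝ => expDecay α t * ∫⁻ y, nJumpProb Q n t y B ∂Q x :=
      (measurable_expDecay_right _).mul hI
    -- Conditioning on the first jump time makes the probability with one more jump a convolution in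
    -- time, which remains a convolution after discounting since exp(-αt) = exp(-αs) exp(-α(t - s)).
    rw [h1, ← lintegral_convolution (measurable_expDecay_right _) hG]
    refine lintegral_congr fun t => ?_
    rw [nJumpProb, ← lintegral_const_mul']
    · refine lintegral_congr fun s => ?_
      rw [← hmul]
      have : expDecay α t = expDecay α s * expDecay α (t - s) := by
        rw [expDecay, expDecay, expDecay, ← ENNReal.ofReal_mul (by positivity), ← Real.exp_add]
        congr 2; ring
      rw [this]
      simp only [expDecay]
      ring
    · exact ENNReal.ofReal_ne_top

theorem measurable_transProb (h : RegularRates Q q₀) (hB : MeasurableSet B) :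
    Measurable fun p : ℝ × X => transProb Q p.1 p.2 B :=
  Measurable.tsum fun n => h.measurable_nJumpProb hB n

theorem laplace_transProb (h : RegularRates Q q₀) (hB : MeasurableSet B) (α : ℝ≥0) (x : X) :
    ∫⁻ t in Set.Ioi (0 : ℝ), expDecay α t * transProb Q t x B =
      resolvent Q α (B.indicator 1) x := by
  simp only [transProb, ← ENNReal.tsum_mul_left]
  rw [lintegral_tsum]
  · exact tsum_congr fun n => h.laplace_nJumpProb hB α n x
  · exact fun n => ((measurable_expDecay_right _).mul ((h.measurable_nJumpProb hB n).comp
      (measurable_id.prodMk measurable_const))).aemeasurable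

/-- The undiscounted case of the Laplace transform: it brings the definitions of recurrence and
transience to the embedded chain. -/
theorem potential_eq (h : RegularRates Q q₀) (hB : MeasurableSet B) (x : X) :
    potential Q x B = resolvent Q 0 (B.indicator 1) x := by
  rw [← h.laplace_transProb hB, potential]
  simp [expDecay]

end RegularRates

end JumpProcess

/-! ## Recurrence and transience of jump processes with an accessible atom -/

namespace JumpProcess

variable {X : Type*} [MeasurableSpace X]

/-- An irreducibility measure is nonzero, so it charges one of the countably many uniformly
transient sets, where the potential would be both bounded and infinite. -/
theorem Transient.not_recurrent {Q : X → Measure X} (ht : Transient Q) : ¬ Recurrent Q := by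
  rintro ⟨⟨φ, hφ⟩, hr⟩
  obtain ⟨A, hA, hAu, hb⟩ := ht
  obtain ⟨i, hi⟩ : ∃ i, φ (A i) ≠ 0 := by
    by_contra! h0
    refine hφ.2.1 (Measure.measure_univ_eq_zero.1 ?_)
    rw [← hAu]
    exact measure_iUnion_null h0
  obtain ⟨x, hx⟩ := nonempty_of_measure_ne_zero hi
  obtain ⟨c, hc⟩ := hb i
  have := hc x hx
  rw [hr φ hφ (A i) (hA i) hi x] at this
  exact absurd this (by simp)

theorem mul_indicator_singleton {X : Type*} (φ : X → ℝ≥0∞) (o : X) :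
    (fun y => φ y * ({o} : Set X).indicator 1 y) = fun y => φ o * ({o} : Set X).indicator 1 y := by
  funext y
  by_cases hy : y = o <;> simp [hy]

namespace RegularRates

variable {Q : X → Measure X} {q₀ : ℝ≥0∞} {f g : X → ℝ≥0∞} {B : Set X}
  [MeasurableSingletonClass X] {o : X}

theorem visits_measurable (o : X) : Measurable (({o} : Set X).indicator (1 : X → ℝ≥0∞)) :=
  measurable_one.indicator (measurableSet_singleton o)

/-- The holding rate is constant on a single point, so time at `o` and number of visits to `o`
differ by a finite nonzero factor. -/
theorem resolvent_atom (h : RegularRates Q q₀) (α : ℝ≥0) (o x : X) :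
    resolvent Q α (({o} : Set X).indicator 1) x = ((α : ℝ≥0∞) + Q o Set.univ)⁻¹ *
      greenOp (killedStep Q α) (({o} : Set X).indicator 1) x := by
  rw [resolvent, mul_indicator_singleton (fun y => ((α : ℝ≥0∞) + Q y Set.univ)⁻¹),
    greenOp_const_mul (h.measurable_killedStep α) (visits_measurable o)]

theorem greenOp_atom_eq (h : RegularRates Q q₀) (α : ℝ≥0) (o x : X) :
    greenOp (killedStep Q α) (({o} : Set X).indicator 1) x =
      ((α : ℝ≥0∞) + Q o Set.univ) * resolvent Q α (({o} : Set X).indicator 1) x := by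
  rw [h.resolvent_atom, ← mul_assoc, ENNReal.mul_inv_cancel (h.add_ne_zero α o)
    (h.add_ne_top α o), one_mul]

/-- A function charged by the Green operator at a recurrent atom has infinite Green function at
every point from which the atom is accessible. -/
theorem greenOp_eq_top {κ : X → Measure X} (hκ : Measurable κ) {φ : X → ℝ≥0∞} {x y : X} (hxy : greenOp κ (({y} : Set X).indicator 1) x = ∞)
    (hy : greenOp κ φ y ≠ 0) : greenOp κ φ x = ∞ := by
  obtain ⟨m, hm⟩ : ∃ m, (kernelOp κ)^[m] φ y ≠ 0 := by
    by_contra! h0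
    exact hy (by simp [greenOp, h0])
  set c := (kernelOp κ)^[m] φ y
  have h1 : (fun z => c * ({y} : Set X).indicator 1 z) ≤ (kernelOp κ)^[m] φ := fun z => by
    by_cases hz : z = y
    · subst hz; simp [c]
    · simp [hz]
  have h2 : c * greenOp κ (({y} : Set X).indicator 1) x ≤ greenOp κ φ x := by
    rw [← greenOp_const_mul hκ (visits_measurable y)]
    refine (greenOp_mono κ h1 x).trans ?_
    simp only [greenOp, ← Function.iterate_add_apply]
    exact ENNReal.tsum_comp_le_tsum_of_injective (add_left_injective m)
      fun n => (kernelOp κ)^[n] φ x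
  rw [hxy, ENNReal.mul_top hm, top_le_iff] at h2
  exact h2

/-- Some number m of steps leads from `x` to `o` with positive mass; the visits counted after that
time already have infinite expectation. -/
theorem greenOp_atom_eq_top {κ : X → Measure X} (hκ : Measurable κ) {x : X}
    (ho : greenOp κ (({o} : Set X).indicator 1) o = ∞)
    (hx : greenOp κ (({o} : Set X).indicator 1) x ≠ 0) :
    greenOp κ (({o} : Set X).indicator 1) x = ∞ := by
  obtain ⟨m, hm⟩ : ∃ m, (kernelOp κ)^[m] (({o} : Set X).indicator 1) x ≠ 0 := by
    by_contra! h0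
    exact hx (by simp [greenOp, h0])
  have h1 : ∀ n, (kernelOp κ)^[m] (({o} : Set X).indicator 1) x *
      (kernelOp κ)^[n] (({o} : Set X).indicator 1) o ≤
      (kernelOp κ)^[m + n] (({o} : Set X).indicator 1) x := fun n => by
    rw [Function.iterate_add_apply, mul_comm,
      ← congrFun (kernelOp_iterate_const_mul hκ (visits_measurable o) _ m) x]
    refine kernelOp_iterate_mono κ (fun z => ?_) m x
    by_cases hz : z = o
    · subst hz; simp
    · simp [hz]
  have h2 : (kernelOp κ)^[m] (({o} : Set X).indicator 1) x *
      greenOp κ (({o} : Set X).indicator 1) o ≤ greenOp κ (({o} : Set X).indicator 1) x := by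
    rw [greenOp, ← ENNReal.tsum_mul_left]
    exact (ENNReal.tsum_le_tsum h1).trans (ENNReal.tsum_comp_le_tsum_of_injective
      (add_right_injective m) fun n => (kernelOp κ)^[n] _ x)
  rw [ho, ENNReal.mul_top hm, top_le_iff] at h2
  exact h2

/-- The Dirac mass at `o` is an irreducibility measure. A set charged by any irreducibility measure
is reached from `o`, and the infinite expected number of visits to `o` makes its potential infinite.
-/
theorem recurrent_of_atom (h : RegularRates Q q₀)
    (hacc : ∀ x, resolvent Q 0 (({o} : Set X).indicator 1) x ≠ 0)
    (ho : resolvent Q 0 (({o} : Set X).indicator 1) o = ∞) : Recurrent Q := by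
  have hG : greenOp (killedStep Q 0) (({o} : Set X).indicator 1) o = ∞ := by
    rw [h.greenOp_atom_eq, ho, ENNReal.mul_top (h.add_ne_zero 0 o)]
  have hK := h.measurable_killedStep 0
  refine ⟨⟨Measure.dirac o, inferInstance, Measure.dirac_ne_zero, fun B hB hoB x => ?_⟩,
    fun φ hφ B hB hφB x => ?_⟩
  · have hoB' : o ∈ B := by
      by_contra hn
      exact hoB (by simp [Measure.dirac_apply' o hB, hn])
    rw [h.potential_eq hB]
    refine (pos_iff_ne_zero.2 (hacc x)).trans_le (greenOp_mono _ (fun y => ?_) x)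
    refine mul_le_mul_right ?_ _
    exact Set.indicator_le_indicator_of_subset (Set.singleton_subset_iff.2 hoB')
      (fun _ => zero_le) y
  · have hpos := hφ.2.2 B hB hφB o
    rw [h.potential_eq hB] at hpos ⊢
    refine greenOp_eq_top hK
      (greenOp_atom_eq_top hK hG ?_) hpos.ne'
    rw [h.greenOp_atom_eq]
    exact mul_ne_zero (h.add_ne_zero 0 o) (hacc x)

/-- Let S_j(x) be the expected number of visits to `o` in the first j terms of the Green series. The
sets {S_j > 1/(j+1)} cover the space because S_j increases to a positive limit. On such a set the
indicator is at most (j+1) S_j, and the Green function of S_j is at most j times the supremum of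
that of `o`, itself bounded by first passage. -/
theorem transient_of_atom (h : RegularRates Q q₀)
    (hacc : ∀ x, resolvent Q 0 (({o} : Set X).indicator 1) x ≠ 0)
    (ho : resolvent Q 0 (({o} : Set X).indicator 1) o ≠ ∞) : Transient Q := by
  have hK := h.measurable_killedStep 0
  have h1 := visits_measurable o
  set G := greenOp (killedStep Q 0) (({o} : Set X).indicator 1) with hGdef
  have hGo : G o ≠ ∞ := by
    rw [hGdef, h.greenOp_atom_eq]
    exact ENNReal.mul_ne_top (h.add_ne_top 0 o) ho
  have hGle : ∀ x, G x ≤ 1 + G o := fun x => by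
    refine (greenOp_visits_le hK o x).trans ?_
    gcongr
    exact mul_le_of_le_one_left' (hitProb_le_one hK o (h.killedStep_univ_le_one 0) x)
  let S : ℕ → X → ℝ≥0∞ := fun j x =>
    ∑ n ∈ Finset.range j, (kernelOp (killedStep Q 0))^[n] (({o} : Set X).indicator 1) x
  have hS : ∀ j, Measurable (S j) := fun j =>
    Finset.measurable_fun_sum _ fun n _ => measurable_kernelOp_iterate hK h1 n
  have hA : ∀ j : ℕ, MeasurableSet {x | ((j : ℝ≥0∞) + 1)⁻¹ < S j x} := fun j =>
    measurableSet_lt measurable_const (hS j)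
  have hinv : q₀⁻¹ ≠ ∞ := ENNReal.inv_ne_top.2 h.ne_zero
  refine ⟨fun j : ℕ => {x | ((j : ℝ≥0∞) + 1)⁻¹ < S j x}, hA, ?_, fun j => ?_⟩
  · refine Set.eq_univ_of_forall fun x => Set.mem_iUnion.2 ?_
    have hGx : 0 < G x := by
      rw [hGdef, h.greenOp_atom_eq]
      exact pos_iff_ne_zero.2 (mul_ne_zero (h.add_ne_zero 0 o) (hacc x))
    obtain ⟨c, hc0, hc⟩ := exists_between hGx
    have hlim : Filter.Tendsto (fun j => S j x) Filter.atTop (nhds (G x)) :=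
      ENNReal.tendsto_nat_tsum _
    have hlim2 : Filter.Tendsto (fun j : ℕ => ((j : ℝ≥0∞) + 1)⁻¹) Filter.atTop (nhds 0) := by
      have := (Filter.tendsto_add_atTop_iff_nat 1).2 ENNReal.tendsto_inv_nat_nhds_zero
      simpa using this
    obtain ⟨j, hj1, hj2⟩ := ((hlim.eventually_const_lt hc).and
      (hlim2.eventually_lt_const hc0)).exists
    exact ⟨j, hj2.trans hj1⟩
  · have hj0 : ((j : ℝ≥0∞) + 1) ≠ 0 := by simp
    have hjt : ((j : ℝ≥0∞) + 1) ≠ ∞ := by simp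
    set C := q₀⁻¹ * (((j : ℝ≥0∞) + 1) * (j * (1 + G o)))
    have hC : C ≠ ∞ := ENNReal.mul_ne_top hinv (ENNReal.mul_ne_top hjt
      (ENNReal.mul_ne_top (by simp) (by simpa using hGo)))
    refine ⟨C.toNNReal, fun x _ => ?_⟩
    rw [ENNReal.coe_toNNReal hC, h.potential_eq (hA j), resolvent]
    have hle : (fun y => (((0 : ℝ≥0) : ℝ≥0∞) + Q y Set.univ)⁻¹ *
        {x | ((j : ℝ≥0∞) + 1)⁻¹ < S j x}.indicator 1 y) ≤
        fun y => q₀⁻¹ * (((j : ℝ≥0∞) + 1) * S j y) := fun y => by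
      refine mul_le_mul' ?_ ?_
      · rw [ENNReal.coe_zero, zero_add]
        exact ENNReal.inv_le_inv.2 (h.le y)
      · refine Set.indicator_le' (f := (1 : X → ℝ≥0∞)) (g := fun y => ((j : ℝ≥0∞) + 1) * S j y)
          (fun y hy => ?_) (fun _ _ => zero_le) y
        have : ((j : ℝ≥0∞) + 1) * ((j : ℝ≥0∞) + 1)⁻¹ ≤ ((j : ℝ≥0∞) + 1) * S j y := by
          gcongr
          exact le_of_lt hy
        rwa [ENNReal.mul_inv_cancel hj0 hjt] at this
    refine (greenOp_mono _ hle x).trans ?_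
    rw [greenOp_const_mul hK ((hS j).const_mul _), greenOp_const_mul hK (hS j)]
    refine mul_le_mul_right (mul_le_mul_right ?_ _) _
    simp only [greenOp, S]
    simp_rw [kernelOp_iterate_sum hK (fun i => measurable_kernelOp_iterate hK h1 i)]
    rw [Summable.tsum_finsetSum (fun _ _ => ENNReal.summable)]
    calc _ ≤ ∑ i ∈ Finset.range j, (1 + G o) := by
          refine Finset.sum_le_sum fun i _ => le_trans ?_ (hGle x)
          simp only [← Function.iterate_add_apply]
          exact ENNReal.tsum_comp_le_tsum_of_injective (add_left_injective i)
            fun n => (kernelOp (killedStep Q 0))^[n] (({o} : Set X).indicator 1) x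
      _ = _ := by rw [Finset.sum_const, Finset.card_range, nsmul_eq_mul]

end RegularRates

end JumpProcess

/-! ## Invariant measures of jump processes -/

namespace JumpProcess

variable {X : Type*} [MeasurableSpace X]

theorem lintegral_Ioc_sub_left (F : ℝ → ℝ≥0∞) (t : ℝ) :
    ∫⁻ s in Set.Ioc (0 : ℝ) t, F (t - s) = ∫⁻ s in Set.Ioc (0 : ℝ) t, F s := by
  rw [← setLIntegral_congr Ioo_ae_eq_Ioc, ← setLIntegral_congr Ioo_ae_eq_Ioc,
    ← lintegral_indicator measurableSet_Ioo, ← lintegral_indicator measurableSet_Ioo,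
    ← lintegral_sub_left_eq_self _ t]
  refine lintegral_congr fun s => ?_
  by_cases h0 : 0 < s <;> by_cases h1 : s < t <;> simp [Set.indicator, h0, h1]

/-- Tonelli's theorem for the primitive of a convolution. -/
theorem lintegral_Ioc_convolution {F G : ℝ → ℝ≥0∞} (hF : Measurable F) (hG : Measurable G)
    (t : ℝ) :
    ∫⁻ s in Set.Ioc (0 : ℝ) t, ∫⁻ r in Set.Ioc (0 : ℝ) s, F r * G (s - r) =
      ∫⁻ r in Set.Ioc (0 : ℝ) t, (∫⁻ s in Set.Ioc (0 : ℝ) (t - r), F s) * G r := by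
  have hF' : Measurable ((Set.Ioi (0 : ℝ)).indicator F) := hF.indicator measurableSet_Ioi
  have h1 : ∀ s ∈ Set.Ioc (0 : ℝ) t, ∫⁻ r in Set.Ioc (0 : ℝ) s, F r * G (s - r) =
      ∫⁻ r in Set.Ioc (0 : ℝ) t, (Set.Ioi (0 : ℝ)).indicator F (s - r) * G r := by
    intro s hs
    have h2 := lintegral_Ioc_sub_left (fun r => F (s - r) * G r) s
    simp only [sub_sub_cancel] at h2
    rw [h2, ← setLIntegral_congr Ioo_ae_eq_Ioc, ← lintegral_indicator measurableSet_Ioo,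
      ← lintegral_indicator measurableSet_Ioc]
    refine lintegral_congr fun r => ?_
    by_cases h0 : 0 < r <;> by_cases h3 : r < s
    · simp [Set.indicator, h0, h3, (h3.trans_le hs.2).le]
    all_goals simp [Set.indicator, h0, h3]
  rw [setLIntegral_congr_fun measurableSet_Ioc h1, lintegral_lintegral_swap]
  · refine setLIntegral_congr_fun measurableSet_Ioc fun r hr => ?_
    rw [lintegral_mul_const _ (by exact hF'.comp (measurable_id.sub_const r))]
    congr 1
    rw [← lintegral_indicator measurableSet_Ioc, ← lintegral_indicator measurableSet_Ioc,
      ← lintegral_sub_right_eq_self ((Set.Ioc 0 (t - r)).indicator fun s => F s) r]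
    refine lintegral_congr fun s => ?_
    by_cases h0 : r < s <;> by_cases h3 : s ≤ t
    · simp [Set.indicator, h0, h3, hr.1.trans h0]
    all_goals simp [Set.indicator, h0, h3]
  · exact ((hF'.comp (measurable_fst.sub measurable_snd)).mul
      (hG.comp measurable_snd)).aemeasurable

/-- Integrated form of a backward equation with constant rate. -/
theorem add_mul_lintegral_of_backward {c : ℝ} (hc : 0 ≤ c) {a : ℝ≥0∞} {u w : ℝ → ℝ≥0∞}
    (hw : Measurable w)
    (hu : ∀ t, u t = expDecay c t * a + ∫⁻ s in Set.Ioc (0 : ℝ) t, expDecay c s * w (t - s))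
    {t : ℝ} (ht : 0 ≤ t) :
    u t + ENNReal.ofReal c * ∫⁻ s in Set.Ioc (0 : ℝ) t, u s =
      a + ∫⁻ s in Set.Ioc (0 : ℝ) t, w s := by
  have he := measurable_expDecay_right c
  have h2 := lintegral_Ioc_sub_left (fun r => expDecay c (t - r) * w r) t
  simp only [sub_sub_cancel] at h2
  have h3 : ∫⁻ s in Set.Ioc (0 : ℝ) t, u s = (∫⁻ s in Set.Ioc (0 : ℝ) t, expDecay c s) * a +
      ∫⁻ r in Set.Ioc (0 : ℝ) t, (∫⁻ s in Set.Ioc (0 : ℝ) (t - r), expDecay c s) * w r := by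
    simp_rw [hu]
    rw [lintegral_add_left (he.mul_const a), lintegral_mul_const _ he,
      lintegral_Ioc_convolution he hw]
  -- Here 1 is split by `lintegral_Ioc_expDecay` at the remaining time t - r.
  have h4 : ∫⁻ r in Set.Ioc (0 : ℝ) t, w r =
      (∫⁻ r in Set.Ioc (0 : ℝ) t, expDecay c (t - r) * w r) + ENNReal.ofReal c *
      ∫⁻ r in Set.Ioc (0 : ℝ) t, (∫⁻ s in Set.Ioc (0 : ℝ) (t - r), expDecay c s) * w r := by
    rw [← lintegral_const_mul' _ _ ENNReal.ofReal_ne_top, ← lintegral_add_left]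
    · refine setLIntegral_congr_fun measurableSet_Ioc fun r hr => ?_
      rw [← mul_assoc, ← add_mul, add_comm,
        lintegral_Ioc_expDecay hc (sub_nonneg.2 hr.2), one_mul]
    · exact (he.comp (measurable_const.sub measurable_id)).mul hw
  rw [h3, h4, hu t, h2, mul_add, ← mul_assoc]
  nth_rw 3 [← one_mul a]
  rw [← lintegral_Ioc_expDecay hc ht]
  ring

/-! ### Backward equation, balance and discounted invariance. -/

namespace RegularRates

variable {Q : X → Measure X} {q₀ : ℝ≥0∞} {f g : X → ℝ≥0∞} {B : Set X}

theorem lintegral_Ioc_nJumpProb_measurable (h : RegularRates Q q₀) (hB : MeasurableSet B) (n : ℕ)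
    (t : ℝ) (x : X) :
    Measurable fun s : ℝ => expDecay (Q x Set.univ).toReal s *
      ∫⁻ y, nJumpProb Q n (t - s) y B ∂Q x :=
  (measurable_expDecay_right _).mul ((h.measurable_lintegral_joint
    (F := fun t y => nJumpProb Q n t y B) (h.measurable_nJumpProb hB n)).comp
      ((measurable_const.sub measurable_id).prodMk measurable_const))

theorem measurable_section (h : RegularRates Q q₀) (hB : MeasurableSet B) (n : ℕ) (t : ℝ) :
    Measurable fun y => nJumpProb Q n t y B :=
  (h.measurable_nJumpProb hB n).comp (measurable_const.prodMk measurable_id)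

/-- The backward equation. -/
theorem transProb_eq (h : RegularRates Q q₀) (hB : MeasurableSet B) (t : ℝ) (x : X) :
    transProb Q t x B = expDecay (Q x Set.univ).toReal t * B.indicator 1 x +
      ∫⁻ s in Set.Ioc (0 : ℝ) t, expDecay (Q x Set.univ).toReal s *
        ∫⁻ y, transProb Q (t - s) y B ∂Q x := by
  rw [transProb, tsum_eq_zero_add' ENNReal.summable]
  congr 1
  have h1 : ∀ n, nJumpProb Q (n + 1) t x B = ∫⁻ s in Set.Ioc (0 : ℝ) t,
      expDecay (Q x Set.univ).toReal s * ∫⁻ y, nJumpProb Q n (t - s) y B ∂Q x := fun _ => rfl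
  simp only [transProb, h1]
  rw [← lintegral_tsum fun n => (h.lintegral_Ioc_nJumpProb_measurable hB n t x).aemeasurable]
  refine lintegral_congr fun s => ?_
  rw [lintegral_tsum fun n => (h.measurable_section hB n _).aemeasurable, ENNReal.tsum_mul_left]

/-- Induction on the number of jumps taken into account: the first jump either has not occurred by
time t or leads to a state where the previous bound applies. -/
theorem transProb_le_one (h : RegularRates Q q₀) (hB : MeasurableSet B) {t : ℝ} (ht : 0 ≤ t)
    (x : X) : transProb Q t x B ≤ 1 := by
  rw [transProb, ENNReal.tsum_eq_iSup_nat]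
  refine iSup_le fun N => ?_
  induction N generalizing t x with
  | zero => simp
  | succ N ih =>
    rw [Finset.sum_range_succ', add_comm, ← lintegral_Ioc_expDecay
      (c := (Q x Set.univ).toReal) ENNReal.toReal_nonneg ht, add_comm]
    refine add_le_add ?_ (mul_le_of_le_one_right' (Set.indicator_le_self' (fun _ _ => zero_le) x))
    have h1 : ∀ n, nJumpProb Q (n + 1) t x B = ∫⁻ s in Set.Ioc (0 : ℝ) t,
        expDecay (Q x Set.univ).toReal s * ∫⁻ y, nJumpProb Q n (t - s) y B ∂Q x := fun _ => rfl
    simp only [h1]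
    rw [← lintegral_finsetSum _ fun n _ => h.lintegral_Ioc_nJumpProb_measurable hB n t x,
      mul_comm, ← lintegral_mul_const _ (measurable_expDecay_right _)]
    refine setLIntegral_mono' measurableSet_Ioc fun s hs => ?_
    rw [← Finset.mul_sum, ← lintegral_finsetSum _ fun n _ => h.measurable_section hB n _]
    refine mul_le_mul_right ?_ _
    rw [ENNReal.ofReal_toReal (h.ne_top x)]
    refine (lintegral_mono fun y => ih (sub_nonneg.2 hs.2) y).trans ?_
    rw [lintegral_one]

/-- A measure that balances the jump rates, with finite total rate, is invariant. -/
theorem lintegral_transProb_of_balance (h : RegularRates Q q₀) {μ : Measure X} [SFinite μ]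
    (hbal : ∀ f : X → ℝ≥0∞, Measurable f →
      ∫⁻ x, kernelOp Q f x ∂μ = ∫⁻ x, Q x Set.univ * f x ∂μ)
    (hfin : ∫⁻ x, Q x Set.univ ∂μ ≠ ∞) (hB : MeasurableSet B) {t : ℝ} (ht : 0 ≤ t) :
    ∫⁻ x, transProb Q t x B ∂μ = μ B := by
  have hP := h.measurable_transProb hB
  have hPt : ∀ s, Measurable fun x => transProb Q s x B := fun s =>
    hP.comp (measurable_const.prodMk measurable_id)
  have hw : Measurable fun p : ℝ × X => ∫⁻ y, transProb Q p.1 y B ∂Q p.2 :=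
    h.measurable_lintegral_joint (F := fun t y => transProb Q t y B) hP
  -- The backward equation integrated in time, with loss and gain terms on opposite sides. Balance
  -- makes their integrals against `μ` equal.
  have key : ∀ x, transProb Q t x B + Q x Set.univ * ∫⁻ s in Set.Ioc (0 : ℝ) t, transProb Q s x B =
      B.indicator 1 x + ∫⁻ s in Set.Ioc (0 : ℝ) t, ∫⁻ y, transProb Q s y B ∂Q x := fun x => by
    have := add_mul_lintegral_of_backward (c := (Q x Set.univ).toReal) ENNReal.toReal_nonneg
      (u := fun s => transProb Q s x B) (w := fun s => ∫⁻ y, transProb Q s y B ∂Q x)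
      (hw.comp (measurable_id.prodMk measurable_const)) (fun s => h.transProb_eq hB s x) ht
    rwa [ENNReal.ofReal_toReal (h.ne_top x)] at this
  have hswap1 : ∫⁻ x, (Q x Set.univ * ∫⁻ s in Set.Ioc (0 : ℝ) t, transProb Q s x B) ∂μ =
      ∫⁻ s in Set.Ioc (0 : ℝ) t, ∫⁻ x, Q x Set.univ * transProb Q s x B ∂μ := by
    have h1 : ∀ x, Q x Set.univ * ∫⁻ s in Set.Ioc (0 : ℝ) t, transProb Q s x B =
        ∫⁻ s in Set.Ioc (0 : ℝ) t, Q x Set.univ * transProb Q s x B := fun x =>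
      (lintegral_const_mul _ (hP.comp (measurable_id.prodMk measurable_const))).symm
    rw [lintegral_congr h1, lintegral_lintegral_swap]
    · exact ((h.measurable_rate.comp measurable_fst).mul (hP.comp measurable_swap)).aemeasurable
  have hswap2 : ∫⁻ x, (∫⁻ s in Set.Ioc (0 : ℝ) t, ∫⁻ y, transProb Q s y B ∂Q x) ∂μ =
      ∫⁻ s in Set.Ioc (0 : ℝ) t, ∫⁻ x, Q x Set.univ * transProb Q s x B ∂μ := by
    rw [lintegral_lintegral_swap]
    · exact lintegral_congr fun s => hbal _ (hPt s)
    · exact (hw.comp measurable_swap).aemeasurable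
  -- Finiteness of the total rate is what allows the equal loss and gain terms to be cancelled.
  have hne : ∫⁻ s in Set.Ioc (0 : ℝ) t, ∫⁻ x, Q x Set.univ * transProb Q s x B ∂μ ≠ ∞ := by
    refine ne_top_of_le_ne_top (b := ∫⁻ _ in Set.Ioc (0 : ℝ) t, ∫⁻ x, Q x Set.univ ∂μ) ?_ ?_
    · rw [setLIntegral_const]
      exact ENNReal.mul_ne_top hfin (by simp)
    · refine setLIntegral_mono' measurableSet_Ioc fun s hs => lintegral_mono fun x => ?_
      exact mul_le_of_le_one_right' (h.transProb_le_one hB hs.1.le x)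
  have hint := lintegral_congr (μ := μ) key
  rw [lintegral_add_left (hPt t), lintegral_add_left (measurable_one.indicator hB), hswap1,
    hswap2, lintegral_indicator_one hB] at hint
  exact (ENNReal.add_left_inj hne).1 hint

/-- Invariance at each time is averaged over an exponential time of rate α. -/
theorem invariant_resolvent (h : RegularRates Q q₀) {π : Measure X} (hπ : IsInvariantProb Q π)
    (hB : MeasurableSet B) {α : ℝ≥0} (hα : 0 < α) :
    (α : ℝ≥0∞) * ∫⁻ x, resolvent Q α (B.indicator 1) x ∂π = π B := by
  have := hπ.1
  have hP := h.measurable_transProb hB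
  simp_rw [← h.laplace_transProb hB]
  rw [lintegral_lintegral_swap]
  · have h1 : ∀ t ∈ Set.Ioi (0 : ℝ), ∫⁻ x, expDecay α t * transProb Q t x B ∂π =
        expDecay α t * π B := fun t ht => by
      rw [lintegral_const_mul _ (by exact hP.comp (measurable_const.prodMk measurable_id)),
        hπ.2 t (le_of_lt ht) B hB]
    rw [setLIntegral_congr_fun measurableSet_Ioi h1,
      lintegral_mul_const _ (measurable_expDecay_right _), lintegral_expDecay (by exact hα),
      ENNReal.ofReal_coe_nnreal, ← mul_assoc,
      ENNReal.mul_inv_cancel (by simpa using hα.ne') ENNReal.coe_ne_top, one_mul]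
  · exact (((measurable_expDecay_right _).comp measurable_snd).mul
      (hP.comp measurable_swap)).aemeasurable

/-- The n-th term contains n + 1 factors of the form `(α + q)⁻¹`, and introducing the killing costs
at most a factor θ in each. -/
theorem pow_mul_iterate_taboo_le (Q : X → Measure X) (o : X) {θ : ℝ≥0∞} {α : ℝ≥0}
    (hθt : θ ≠ ∞) (hθ : ∀ y, θ * (((0 : ℝ≥0) : ℝ≥0∞) + Q y Set.univ)⁻¹ ≤
      ((α : ℝ≥0∞) + Q y Set.univ)⁻¹) (n : ℕ) (x : X) :
    θ ^ (n + 1) * (kernelOp (taboo (killedStep Q 0) o))^[n]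
        (fun y => (((0 : ℝ≥0) : ℝ≥0∞) + Q y Set.univ)⁻¹) x ≤
      (kernelOp (taboo (killedStep Q α) o))^[n] (fun y => ((α : ℝ≥0∞) + Q y Set.univ)⁻¹) x := by
  have hT : ∀ (β : ℝ≥0) (g : X → ℝ≥0∞) (x : X), kernelOp (taboo (killedStep Q β) o) g x =
      ((β : ℝ≥0∞) + Q x Set.univ)⁻¹ * kernelOp (taboo Q o) g x := fun β g x => by
    rw [kernelOp, taboo, killedStep, Measure.restrict_smul, lintegral_smul_measure]
    rfl
  induction n generalizing x with
  | zero => simpa using hθ x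
  | succ n ih =>
    simp only [Function.iterate_succ_apply', hT]
    calc _ = (θ * (((0 : ℝ≥0) : ℝ≥0∞) + Q x Set.univ)⁻¹) * (θ ^ (n + 1) *
          kernelOp (taboo Q o) ((kernelOp (taboo (killedStep Q 0) o))^[n]
            fun y => (((0 : ℝ≥0) : ℝ≥0∞) + Q y Set.univ)⁻¹) x) := by ring
      _ ≤ _ := by
        refine mul_le_mul' (hθ x) ?_
        rw [kernelOp, ← lintegral_const_mul' _ _ (ENNReal.pow_ne_top hθt)]
        exact lintegral_mono fun y => ih y

/-- The α-resolvent is at most the potential; were the latter finite, α times it would tend to 0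
with α. -/
theorem resolvent_eq_top_of_le {o : X} {c : ℝ≥0∞} (hc0 : c ≠ 0)
    (hc : ∀ α : ℝ≥0, 0 < α → c ≤ α * resolvent Q α (({o} : Set X).indicator 1) o) :
    resolvent Q 0 (({o} : Set X).indicator 1) o = ∞ := by
  by_contra hne
  obtain ⟨α, hα, hlt⟩ : ∃ α : ℝ≥0, 0 < α ∧
      α * resolvent Q 0 (({o} : Set X).indicator 1) o < c := by
    obtain ⟨α, hα, hlt⟩ := ENNReal.exists_nnreal_pos_mul_lt hne hc0
    exact ⟨α, hα, hlt⟩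
  refine absurd hlt (not_lt.2 ((hc α hα).trans ?_))
  gcongr
  exact resolvent_anti α _ o

end RegularRates

/-- The law of a chain started at `o` after `n` steps, killed when it returns to `o`. -/
def tabooLaw (κ : X → Measure X) (o : X) : ℕ → Measure X
  | 0 => Measure.dirac o
  | n + 1 => (tabooLaw κ o n).bind (taboo κ o)

/-- The expected occupation measure of an excursion of the jump process from `o`. -/
def excursionMeasure (Q : X → Measure X) (o : X) : Measure X :=
  (Measure.sum (tabooLaw (killedStep Q 0) o)).withDensity
    fun y => (((0 : ℝ≥0) : ℝ≥0∞) + Q y Set.univ)⁻¹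

/-! ### Excursions from the atom and positive recurrence. -/

section Excursion

variable [MeasurableSingletonClass X] {Q : X → Measure X} {q₀ : ℝ≥0∞} {o : X}

theorem lintegral_tabooLaw {κ : X → Measure X} (hκ : Measurable κ) (o : X) {f : X → ℝ≥0∞}
    (hf : Measurable f) (n : ℕ) :
    ∫⁻ x, f x ∂tabooLaw κ o n = (kernelOp (taboo κ o))^[n] f o := by
  induction n generalizing f with
  | zero => exact lintegral_dirac' o hf
  | succ n ih =>
    have hT := measurable_taboo hκ o
    rw [tabooLaw, Measure.lintegral_bind hT.aemeasurable hf.aemeasurable,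
      Function.iterate_succ_apply]
    exact ih (measurable_kernelOp hT hf)

namespace RegularRates

theorem lintegral_excursionMeasure (h : RegularRates Q q₀) (o : X) {f : X → ℝ≥0∞}
    (hf : Measurable f) :
    ∫⁻ x, f x ∂excursionMeasure Q o = greenOp (taboo (killedStep Q 0) o)
      (fun y => (((0 : ℝ≥0) : ℝ≥0∞) + Q y Set.univ)⁻¹ * f y) o := by
  rw [excursionMeasure, lintegral_withDensity_eq_lintegral_mul _ (h.measurable_inv 0) hf,
    lintegral_sum_measure]
  exact tsum_congr fun n =>
    lintegral_tabooLaw (h.measurable_killedStep 0) o (h.measurable_inv_mul 0 hf) n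

/-- One more step shifts the steps of an excursion by one. The shift loses the initial visit to `o`,
which the return to `o` restores because recurrence gives it probability one. -/
theorem excursionMeasure_balance (h : RegularRates Q q₀)
    (ho : resolvent Q 0 (({o} : Set X).indicator 1) o = ∞) {f : X → ℝ≥0∞} (hf : Measurable f) :
    ∫⁻ x, kernelOp Q f x ∂excursionMeasure Q o =
      ∫⁻ x, Q x Set.univ * f x ∂excursionMeasure Q o := by
  have hK := h.measurable_killedStep 0
  have hT := measurable_taboo hK o
  have hG : greenOp (killedStep Q 0) (({o} : Set X).indicator 1) o = ∞ := by
    rw [h.greenOp_atom_eq, ho, ENNReal.mul_top (h.add_ne_zero 0 o)]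
  have hH := hitProb_eq_one hK o (h.killedStep_univ_le_one 0) hG
  rw [h.lintegral_excursionMeasure o (measurable_kernelOp h.measurable hf),
    h.lintegral_excursionMeasure o (by exact h.measurable_rate.mul hf)]
  have h1 : (fun y => (((0 : ℝ≥0) : ℝ≥0∞) + Q y Set.univ)⁻¹ * kernelOp Q f y) =
      fun y => f o * killedStep Q 0 y {o} + kernelOp (taboo (killedStep Q 0) o) f y := by
    funext y
    rw [← kernelOp_killedStep, kernelOp_eq_atom_add _ o hf, mul_comm]
  have h2 : (fun y => (((0 : ℝ≥0) : ℝ≥0∞) + Q y Set.univ)⁻¹ * (Q y Set.univ * f y)) = f := by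
    funext y
    rw [ENNReal.coe_zero, zero_add, ← mul_assoc,
      ENNReal.inv_mul_cancel (h.rate_ne_zero y) (h.ne_top y), one_mul]
  have hm := measurable_mass hK (measurableSet_singleton o)
  rw [h1, h2, greenOp_add hT (hm.const_mul _), greenOp_const_mul hT hm]
  change f o * hitProb (killedStep Q 0) o o + _ = _
  rw [hH, mul_one]
  simp only [greenOp, ← Function.iterate_succ_apply]
  exact (tsum_eq_zero_add' (f := fun n => (kernelOp (taboo (killedStep Q 0) o))^[n] f o)
    ENNReal.summable).symm

/-- Finiteness of the total rate of an excursion, by a drift condition. -/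
theorem excursion_rate_ne_top (h : RegularRates Q q₀) {V D : X → ℝ≥0∞} {b : ℝ≥0∞}
    (hV : Measurable V) (hD : Measurable D) (hVo : V o ≠ ∞) (hb : b ≠ ∞)
    (hdrift : ∀ x, kernelOp Q V x + D x ≤ Q x Set.univ * V x + b)
    (hrate : ∀ x, Q x Set.univ = b + D x)
    (hfin : excursionMeasure Q o Set.univ ≠ ∞) :
    ∫⁻ x, Q x Set.univ ∂excursionMeasure Q o ≠ ∞ := by
  have hT := measurable_taboo (h.measurable_killedStep 0) o
  simp_rw [hrate]
  have hbfin : ∫⁻ _, b ∂excursionMeasure Q o ≠ ∞ := by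
    rw [lintegral_const]
    exact ENNReal.mul_ne_top hb hfin
  rw [lintegral_add_left measurable_const]
  refine ENNReal.add_ne_top.2 ⟨hbfin, ?_⟩
  refine ne_top_of_le_ne_top (ENNReal.add_ne_top.2 ⟨hVo, hbfin⟩) ?_
  rw [h.lintegral_excursionMeasure o hD, h.lintegral_excursionMeasure o measurable_const]
  have hbm := h.measurable_inv_mul 0 (f := fun _ => b) measurable_const
  -- A supersolution for the accumulated `D`: by the drift condition the decrease of `V` pays for
  -- `D` up to `b`, and the Green term pays for `b`.
  refine greenOp_le (g := fun x => V x + greenOp (taboo (killedStep Q 0) o)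
    (fun y => (((0 : ℝ≥0) : ℝ≥0∞) + Q y Set.univ)⁻¹ * b) x) hT
    (h.measurable_inv_mul 0 hD) (fun x => ?_) o
  rw [kernelOp_add _ hV]
  beta_reduce
  rw [greenOp_eq hT hbm x, ← add_assoc, ← add_assoc]
  refine add_le_add_left ?_ _
  have h1 : kernelOp (taboo (killedStep Q 0) o) V x ≤ kernelOp (killedStep Q 0) V x := by
    rw [kernelOp_eq_atom_add (killedStep Q 0) o hV]
    exact le_add_self
  calc _ ≤ (((0 : ℝ≥0) : ℝ≥0∞) + Q x Set.univ)⁻¹ * D x + kernelOp (killedStep Q 0) V x := by gcongr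
    _ = (((0 : ℝ≥0) : ℝ≥0∞) + Q x Set.univ)⁻¹ * (kernelOp Q V x + D x) := by
      rw [kernelOp_killedStep, mul_add, add_comm]
    _ ≤ (((0 : ℝ≥0) : ℝ≥0∞) + Q x Set.univ)⁻¹ * (Q x Set.univ * V x + b) := by
      exact mul_le_mul_right (hdrift x) _
    _ = _ := by
      rw [mul_add, ← mul_assoc, ENNReal.coe_zero, zero_add,
        ENNReal.inv_mul_cancel (h.rate_ne_zero x) (h.ne_top x), one_mul]

/-- Lower bounds on the discounted occupation of `o` bound the length of excursions. -/
theorem greenOp_taboo_le_of_resolvent (h : RegularRates Q q₀) {c : ℝ≥0∞} {α : ℝ≥0} (hα : 0 < α)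
    (hc : c ≤ α * resolvent Q α (({o} : Set X).indicator 1) o) :
    greenOp (taboo (killedStep Q α) o) (fun y => ((α : ℝ≥0∞) + Q y Set.univ)⁻¹) o ≤
      (q₀ * c)⁻¹ := by
  have hK := h.measurable_killedStep α
  have hT := measurable_taboo hK o
  have hα0 : (α : ℝ≥0∞) ≠ 0 := by simpa using hα.ne'
  have hR : resolvent Q α (({o} : Set X).indicator 1) o ≠ ∞ :=
    ne_top_of_le_ne_top (ENNReal.inv_ne_top.2 hα0) (h.resolvent_le hα (visits_measurable o)
      (fun x => Set.indicator_le_self' (fun _ _ => zero_le) x) o)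
  have hGt : greenOp (killedStep Q α) (({o} : Set X).indicator 1) o ≠ ∞ := by
    rw [h.greenOp_atom_eq]
    exact ENNReal.mul_ne_top (h.add_ne_top α o) hR
  have key := greenOp_taboo_mul_visits_le_one hK o
    (φ := fun y => (α : ℝ≥0∞) * ((α : ℝ≥0∞) + Q y Set.univ)⁻¹) ((h.measurable_inv α).const_mul _)
    (fun x => by rw [mul_comm]; exact (h.killedStep_univ_le α x).le) hGt
  rw [greenOp_const_mul hT (h.measurable_inv α), h.greenOp_atom_eq] at key
  rw [ENNReal.le_inv_iff_mul_le]
  refine le_trans ?_ key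
  set M := greenOp (taboo (killedStep Q α) o) (fun y => ((α : ℝ≥0∞) + Q y Set.univ)⁻¹) o
  calc M * (q₀ * c) ≤ M * (((α : ℝ≥0∞) + Q o Set.univ) *
        (α * resolvent Q α (({o} : Set X).indicator 1) o)) := by
        gcongr
        exact (h.le o).trans le_add_self
    _ = _ := by ring

/-- The bound on discounted excursion lengths does not depend on α, so it survives the limit α → 0,
taken on each partial sum. -/
theorem excursionMeasure_univ_ne_top (h : RegularRates Q q₀) {c : ℝ≥0∞} (hc0 : c ≠ 0)
    (hc : ∀ α : ℝ≥0, 0 < α → c ≤ α * resolvent Q α (({o} : Set X).indicator 1) o) :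
    excursionMeasure Q o Set.univ ≠ ∞ := by
  have hq0 : q₀ ≠ ∞ := ne_top_of_le_ne_top (h.ne_top o) (h.le o)
  rw [← lintegral_one, h.lintegral_excursionMeasure o measurable_const]
  simp only [mul_one]
  refine ne_top_of_le_ne_top (ENNReal.inv_ne_top.2 (mul_ne_zero h.ne_zero hc0)) ?_
  refine greenOp_le_of_sum_le fun N => ?_
  set S := ∑ n ∈ Finset.range N, (kernelOp (taboo (killedStep Q 0) o))^[n]
    (fun y => (((0 : ℝ≥0) : ℝ≥0∞) + Q y Set.univ)⁻¹) o
  -- The cost per factor of killing at rate α = 1/(k+1), namely q₀/(α + q₀), is uniform in the state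
  -- because all rates are at least q₀; it tends to 1.
  let θ : ℕ → ℝ≥0∞ := fun k => q₀ / ((((k : ℝ≥0) + 1)⁻¹ : ℝ≥0) + q₀)
  have hθ1 : ∀ k, θ k ≤ 1 := fun k => ENNReal.div_le_of_le_mul (by rw [one_mul]; exact le_add_self)
  have hα : Filter.Tendsto (fun k : ℕ => ((((k : ℝ≥0) + 1)⁻¹ : ℝ≥0) : ℝ≥0∞)) Filter.atTop
      (nhds 0) := by
    have := (Filter.tendsto_add_atTop_iff_nat 1).2 ENNReal.tendsto_inv_nat_nhds_zero
    refine this.congr fun k => ?_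
    rw [ENNReal.coe_inv (by positivity)]
    push_cast
    rfl
  have hθ : Filter.Tendsto θ Filter.atTop (nhds 1) := by
    have h1 := ENNReal.Tendsto.const_div (a := q₀) (hα.add_const q₀) (Or.inr hq0)
    rwa [zero_add, ENNReal.div_self h.ne_zero hq0] at h1
  have hlim : Filter.Tendsto (fun k => θ k ^ N * S) Filter.atTop (nhds (1 ^ N * S)) :=
    ENNReal.Tendsto.mul_const (ENNReal.Tendsto.pow hθ) (Or.inl (by simp))
  rw [one_pow, one_mul] at hlim
  refine le_of_tendsto' hlim fun k => ?_
  set α : ℝ≥0 := ((k : ℝ≥0) + 1)⁻¹ with hαk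
  have hαpos : 0 < α := by positivity
  refine le_trans ?_ (h.greenOp_taboo_le_of_resolvent hαpos (hc α hαpos))
  refine le_trans ?_ (sum_le_greenOp _ _ N o)
  rw [Finset.mul_sum]
  refine Finset.sum_le_sum fun n hn => ?_
  refine le_trans ?_ (pow_mul_iterate_taboo_le Q o (θ := θ k)
    ((hθ1 k).trans_lt ENNReal.one_lt_top).ne (fun y => ?_) n o)
  · exact mul_le_mul_left (pow_le_pow_right_of_le_one' (hθ1 k) (Finset.mem_range.1 hn)) _
  · rw [ENNReal.coe_zero, zero_add, ENNReal.le_inv_iff_mul_le, mul_assoc, mul_add,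
      ENNReal.inv_mul_cancel (h.rate_ne_zero y) (h.ne_top y)]
    calc θ k * ((Q y Set.univ)⁻¹ * α + 1) ≤ θ k * (q₀⁻¹ * α + 1) := by
          gcongr
          exact h.le y
      _ = θ k * (q₀⁻¹ * (α + q₀)) := by
        rw [mul_add q₀⁻¹, ENNReal.inv_mul_cancel h.ne_zero hq0]
      _ = ((α + q₀)⁻¹ * (α + q₀)) * (q₀ * q₀⁻¹) := by
        simp only [θ, div_eq_mul_inv, ← hαk]; ring
      _ ≤ 1 * 1 := mul_le_mul' (ENNReal.inv_mul_le_one _) (ENNReal.mul_inv_le_one _)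
      _ = 1 := one_mul 1

/-- Positive recurrence from a lower bound on the discounted occupation of an atom and a drift
condition. -/
theorem positiveRecurrent_of_atom (h : RegularRates Q q₀)
    (hacc : ∀ x, resolvent Q 0 (({o} : Set X).indicator 1) x ≠ 0) {c : ℝ≥0∞} (hc0 : c ≠ 0)
    (hc : ∀ α : ℝ≥0, 0 < α → c ≤ α * resolvent Q α (({o} : Set X).indicator 1) o)
    {V D : X → ℝ≥0∞} {b : ℝ≥0∞} (hV : Measurable V) (hD : Measurable D) (hVo : V o ≠ ∞)
    (hb : b ≠ ∞) (hdrift : ∀ x, kernelOp Q V x + D x ≤ Q x Set.univ * V x + b)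
    (hrate : ∀ x, Q x Set.univ = b + D x) : PositiveRecurrent Q := by
  have ho := resolvent_eq_top_of_le hc0 hc
  refine ⟨h.recurrent_of_atom hacc ho, ?_⟩
  set μ := excursionMeasure Q o with hμ
  have hfin : μ Set.univ ≠ ∞ := h.excursionMeasure_univ_ne_top hc0 hc
  have hpos : μ Set.univ ≠ 0 := by
    rw [← lintegral_one, h.lintegral_excursionMeasure o measurable_const]
    simp only [mul_one]
    refine (lt_of_lt_of_le ?_ (le_greenOp _ _ o)).ne'
    exact ENNReal.inv_pos.2 (h.add_ne_top 0 o)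
  have : IsFiniteMeasure μ := ⟨hfin.lt_top⟩
  refine ⟨(μ Set.univ)⁻¹ • μ, ⟨?_⟩, fun t ht B hB => ?_⟩
  · rw [Measure.smul_apply, smul_eq_mul, ENNReal.inv_mul_cancel hpos hfin]
  · rw [lintegral_smul_measure, h.lintegral_transProb_of_balance
      (fun f hf => h.excursionMeasure_balance ho hf)
      (h.excursion_rate_ne_top hV hD hVo hb hdrift hrate hfin) hB ht, Measure.smul_apply]

end RegularRates

end Excursion

end JumpProcess

/-! ## Measurability of the rates of the spatial birth-and-death process -/

instance (K : ℕ) : MeasurableSingletonClass (BandClass K) := ⟨fun _ => trivial⟩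

namespace Config

variable {a : ℝ} {K : ℕ}

theorem measurable_of_tuple {β : Type*} [MeasurableSpace β] {g : Config a K → β}
    (h : ∀ n, Measurable fun v : Fin n → User a K => g (ofTuple ⟨n, v⟩)) : Measurable g := by
  intro B hB
  change MeasurableSet (ofTuple ⁻¹' (g ⁻¹' B))
  exact MeasurableSpace.measurableSet_iInf.2 fun n => h n hB

theorem measurable_ofTuple (n : ℕ) :
    Measurable fun v : Fin n → User a K => (ofTuple ⟨n, v⟩ : Config a K) := by
  intro B hB
  exact MeasurableSpace.measurableSet_iInf.1
    (show MeasurableSet (ofTuple ⁻¹' B) from hB) n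

theorem exists_ofTuple (ξ : Config a K) : ∃ n, ∃ v : Fin n → User a K, ξ = ofTuple ⟨n, v⟩ := by
  obtain ⟨l, rfl⟩ : ∃ l : List (User a K), (l : Multiset (User a K)) = ξ :=
    ⟨Quotient.out (s := List.isSetoid _) ξ, Quotient.out_eq (s := List.isSetoid _) ξ⟩
  exact ⟨l.length, l.get, by rw [ofTuple, List.ofFn_get]⟩

theorem sum_ofTuple {M : Type*} [AddCommMonoid M] {n : ℕ} (v : Fin n → User a K)
    (f : User a K → M) : (ofTuple ⟨n, v⟩ : Config a K).sum f = ∑ i, f (v i) := by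
  rw [Config.sum, ofTuple, Multiset.map_coe, Multiset.sum_coe, List.map_ofFn, List.sum_ofFn]
  rfl

theorem add_ofTuple {n : ℕ} (v : Fin n → User a K) (u : User a K) :
    (ofTuple ⟨n, v⟩ : Config a K).add u = ofTuple ⟨n + 1, Fin.cons u v⟩ := by
  simp only [ofTuple, add, List.ofFn_cons]
  rfl

/-- Departures become deletions of a coordinate, whose measurability is clear. -/
theorem remove_ofTuple {n : ℕ} (v : Fin (n + 1) → User a K) (i : Fin (n + 1)) :
    (ofTuple ⟨n + 1, v⟩ : Config a K).remove (v i) = ofTuple ⟨n, i.removeNth v⟩ := by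
  classical
  have hof : ∀ (m : ℕ) (w : Fin m → User a K),
      (ofTuple ⟨m, w⟩ : Config a K) = Multiset.map w Finset.univ.val := fun m w => by
    rw [ofTuple, Fin.univ_val_map]
  have h : (ofTuple ⟨n + 1, v⟩ : Config a K) =
      Multiset.cons (v i) (ofTuple ⟨n, i.removeNth v⟩ : Config a K) := by
    rw [hof, hof, Fin.univ_succAbove n i, Finset.cons_val, Multiset.map_cons]
    congr 1
    rw [Finset.map_val, Multiset.map_map]
    rfl
  rw [h]
  change @Multiset.erase _ _ _ _ = _
  convert Multiset.erase_cons_head (v i) (ofTuple ⟨n, i.removeNth v⟩ : Config a K)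

instance [Fact (0 < a)] : MeasurableSingletonClass (User a K) :=
  @Prod.instMeasurableSingletonClass _ _ _ _ _ Prod.instMeasurableSingletonClass

/-- A tuple representing `s` has its entries in the finite support of `s`, so for each length there
are finitely many. -/
theorem measurableSet_eq [Fact (0 < a)] (s : Multiset (User a K)) :
    MeasurableSet ({s} : Set (Config a K)) := by
  change MeasurableSet (ofTuple ⁻¹' {s})
  refine MeasurableSpace.measurableSet_iInf.2 fun n => ?_
  change MeasurableSet {v : Fin n → User a K | (ofTuple ⟨n, v⟩ : Config a K) = s}
  have hfin : Set.Finite {v : Fin n → User a K | ∀ i, v i ∈ {u | u ∈ s}} :=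
    Set.Finite.pi' fun _ => Multiset.finite_toSet s
  refine (hfin.subset ?_).measurableSet
  rintro v rfl i
  change v i ∈ (List.ofFn v : Multiset (User a K))
  simp

instance [Fact (0 < a)] : MeasurableSingletonClass (Config a K) := ⟨measurableSet_eq⟩

/-- The number of users of a configuration. -/
def size (ξ : Config a K) : ℕ := Multiset.card (α := User a K) ξ

theorem size_ofTuple {n : ℕ} (v : Fin n → User a K) : (ofTuple ⟨n, v⟩ : Config a K).size = n := by
  simp [size, ofTuple]

theorem measurable_size : Measurable (size : Config a K → ℕ) :=
  measurable_of_tuple fun n => by simp only [size_ofTuple]; exact measurable_const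

theorem size_add (ξ : Config a K) (u : User a K) : (ξ.add u).size = ξ.size + 1 :=
  Multiset.card_cons u ξ

end Config

theorem torusDist_nonneg {a : ℝ} (x y : SquareTorus a) : 0 ≤ torusDist x y := Real.sqrt_nonneg _

namespace Network

variable (N : Network)

theorem measurable_torusDist : Measurable fun z : SquareTorus N.side × SquareTorus N.side =>
    torusDist z.1 z.2 := by
  unfold torusDist
  have : Continuous fun z : SquareTorus N.side × SquareTorus N.side =>
    Real.sqrt (‖z.1.1 - z.2.1‖ ^ 2 + ‖z.1.2 - z.2.2‖ ^ 2) := by fun_prop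
  exact this.measurable

/-- Interference created at the receiver of the first user by the transmitter of the second. -/
def pairInterference (u v : User N.side N.K) : ℝ :=
  (overlap u.2.2 v.2.2 : ℝ) * N.pathLoss (torusDist u.1 v.2.1)

theorem pairInterference_nonneg (u v : User N.side N.K) : 0 ≤ N.pairInterference u v :=
  mul_nonneg (Nat.cast_nonneg _) (N.pathLoss_nonneg _ (torusDist_nonneg _ _))

theorem measurable_classPair (a : ℝ) (K : ℕ) :
    Measurable fun z : User a K × User a K => (z.1.2.2, z.2.2.2) :=
  (measurable_snd.fun_comp (measurable_snd.fun_comp measurable_fst)).prodMk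
    (measurable_snd.fun_comp (measurable_snd.fun_comp measurable_snd))

theorem measurable_linkPair (a : ℝ) (K : ℕ) :
    Measurable fun z : User a K × User a K => (z.1.1, z.2.2.1) :=
  (measurable_fst.fun_comp measurable_fst).prodMk
    (measurable_fst.fun_comp (measurable_snd.fun_comp measurable_snd))

theorem measurable_overlap_class (K : ℕ) :
    Measurable fun z : BandClass K × BandClass K => (overlap z.1 z.2 : ℝ) :=
  measurable_of_countable _

theorem measurable_overlap (a : ℝ) (K : ℕ) : Measurable fun z : User a K × User a K =>
    (overlap z.1.2.2 z.2.2.2 : ℝ) := by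
  have h := (measurable_overlap_class K).fun_comp (measurable_classPair a K)
  exact h

/-- The path loss is arbitrary on negative reals; truncating its argument gives a function monotone
on the whole line that agrees with it at distances. -/
theorem measurable_pathLoss_max : Measurable fun s : ℝ => N.pathLoss (max s 0) :=
  Antitone.measurable fun s t hst =>
    N.pathLoss_antitone (le_max_right s 0) (le_max_right t 0) (max_le_max_right 0 hst)

theorem measurable_pathLoss_torusDist : Measurable fun z : SquareTorus N.side × SquareTorus N.side =>
    N.pathLoss (torusDist z.1 z.2) := by
  have h3 := N.measurable_pathLoss_max.fun_comp N.measurable_torusDist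
  simpa only [max_eq_left (torusDist_nonneg _ _)] using h3

theorem measurable_pairInterference :
    Measurable fun z : User N.side N.K × User N.side N.K => N.pairInterference z.1 z.2 := by
  have h := (measurable_overlap N.side N.K).fun_mul
    (N.measurable_pathLoss_torusDist.fun_comp (measurable_linkPair N.side N.K))
  exact h

theorem deathRate_ofTuple {n : ℕ} (i : Fin (n + 1)) (v : Fin (n + 1) → User N.side N.K) :
    N.deathRate (v i) (Config.ofTuple ⟨n + 1, v⟩) =
      ((v i).2.2.1.card : ℝ) * N.pathLoss N.r /
        (N.noise + ∑ j, N.pairInterference (v i) (v (i.succAbove j))) / N.L (v i).2.2 := by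
  rw [deathRate, rate, interference, Config.remove_ofTuple, Config.sum_ofTuple]
  rfl

theorem measurable_classFun {n : ℕ} (i : Fin n) (g : BandClass N.K → ℝ) :
    Measurable fun v : Fin n → User N.side N.K => g (v i).2.2 := by
  have h0 : Measurable fun v : Fin n → User N.side N.K => v i := measurable_pi_apply i
  have h := (measurable_of_countable g).fun_comp (measurable_snd.fun_comp
    (measurable_snd.fun_comp h0))
  exact h

theorem measurable_pairInterference_apply {n : ℕ} (i j : Fin n) :
    Measurable fun v : Fin n → User N.side N.K => N.pairInterference (v i) (v j) := by
  have hi : Measurable fun v : Fin n → User N.side N.K => v i := measurable_pi_apply i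
  have hj : Measurable fun v : Fin n → User N.side N.K => v j := measurable_pi_apply j
  have h := N.measurable_pairInterference.fun_comp (hi.prodMk hj)
  exact h

theorem measurable_deathRate_tuple {n : ℕ} (i : Fin (n + 1)) :
    Measurable fun v : Fin (n + 1) → User N.side N.K =>
      N.deathRate (v i) (Config.ofTuple ⟨n + 1, v⟩) := by
  have h1 := N.measurable_classFun i fun C => (C.1.card : ℝ) * N.pathLoss N.r
  have h2 : Measurable fun v : Fin (n + 1) → User N.side N.K =>
      N.noise + ∑ j, N.pairInterference (v i) (v (i.succAbove j)) :=
    Measurable.const_add (Finset.measurable_fun_sum _ fun j _ =>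
      N.measurable_pairInterference_apply i (i.succAbove j)) N.noise
  have h3 := (h1.fun_div h2).fun_div (N.measurable_classFun i N.L)
  simp only [deathRate_ofTuple]
  exact h3

theorem measurable_dipole (C : BandClass N.K) :
    Measurable fun z : SquareTorus N.side × ℝ => N.dipole C z.1 z.2 := by
  have h1 : Measurable fun z : SquareTorus N.side × ℝ => z.1 +
      (((N.r * Real.cos z.2 : ℝ) : AddCircle N.side),
        ((N.r * Real.sin z.2 : ℝ) : AddCircle N.side)) := by
    have hq : Continuous ((↑) : ℝ → AddCircle N.side) := AddCircle.continuous_mk' _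
    refine Continuous.measurable (continuous_fst.add (Continuous.prodMk ?_ ?_))
    · exact hq.comp (by fun_prop)
    · exact hq.comp (by fun_prop)
  exact h1.prodMk (measurable_fst.prodMk measurable_const)

theorem isProbabilityMeasure_directionLaw : IsProbabilityMeasure directionLaw := by
  refine ProbabilityTheory.cond_isProbabilityMeasure_of_finite ?_ ?_
  · simp [Real.pi_pos]
  · rw [Real.volume_Ico]; exact ENNReal.ofReal_ne_top

theorem arrivalMeasure_univ :
    N.arrivalMeasure Set.univ = (volume : Measure (SquareTorus N.side)) Set.univ := by
  have := isProbabilityMeasure_directionLaw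
  have h : ∀ C, ((((volume : Measure (SquareTorus N.side)).prod directionLaw).map
      fun z => N.dipole C z.1 z.2)) Set.univ =
      (volume : Measure (SquareTorus N.side)) Set.univ := fun C => by
    rw [Measure.map_apply (N.measurable_dipole C) MeasurableSet.univ, Set.preimage_univ,
      ← Set.univ_prod_univ, Measure.prod_prod, measure_univ (μ := directionLaw), mul_one]
  simp only [arrivalMeasure, Measure.finsetSum_apply, Measure.smul_apply, h, smul_eq_mul]
  rw [← Finset.sum_mul, ← ENNReal.ofReal_sum_of_nonneg fun C _ => N.p_nonneg C, N.p_sum]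
  simp

theorem arrivalMeasure_univ_ne_top : N.arrivalMeasure Set.univ ≠ ∞ := by
  rw [arrivalMeasure_univ]
  exact measure_ne_top _ _

theorem arrivalMeasure_univ_ne_zero : N.arrivalMeasure Set.univ ≠ 0 := by
  rw [arrivalMeasure_univ, Measure.volume_eq_prod, ← Set.univ_prod_univ, Measure.prod_prod]
  simp [AddCircle.measure_univ, N.side_pos]

instance : IsFiniteMeasure N.arrivalMeasure := ⟨N.arrivalMeasure_univ_ne_top.lt_top⟩

theorem lintegral_config_sum {X : Type*} [MeasurableSpace X] {a : ℝ} {K : ℕ} (ξ : Config a K)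
    (m : User a K → Measure X) (g : X → ℝ≥0∞) :
    ∫⁻ x, g x ∂ξ.sum m = ξ.sum fun u => ∫⁻ x, g x ∂m u := by
  simp only [Config.sum]
  induction (ξ : Multiset (User a K)) using Multiset.induction with
  | empty => simp
  | cons u s ih => simp [ih]

/-- The action of the rates of the process on functions. -/
theorem kernelOp_sbdRates (lam : ℝ≥0) {g : Config N.side N.K → ℝ≥0∞} (hg : Measurable g)
    (ξ : Config N.side N.K) :
    JumpProcess.kernelOp (N.sbdRates lam) g ξ = lam * ∫⁻ u, g (ξ.add u) ∂N.arrivalMeasure +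
      ξ.sum fun u => ENNReal.ofReal (N.deathRate u ξ) * g (ξ.remove u) := by
  rw [JumpProcess.kernelOp, sbdRates, lintegral_add_measure, lintegral_smul_measure,
    lintegral_map hg ξ.measurable_add, lintegral_config_sum]
  simp only [lintegral_smul_measure, lintegral_dirac' _ hg, smul_eq_mul]

/-- Total departure rate. -/
def totalDeathRate (ξ : Config N.side N.K) : ℝ≥0∞ :=
  ξ.sum fun u => ENNReal.ofReal (N.deathRate u ξ)

theorem sbdRates_univ (lam : ℝ≥0) (ξ : Config N.side N.K) :
    N.sbdRates lam ξ Set.univ = lam * N.arrivalMeasure Set.univ + N.totalDeathRate ξ := by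
  rw [← lintegral_one]
  refine (N.kernelOp_sbdRates lam (g := fun _ => 1) measurable_const ξ).trans ?_
  simp [totalDeathRate]

theorem measurable_config_sum {F : User N.side N.K → Config N.side N.K → ℝ≥0∞}
    (hF : Measurable (Function.uncurry F)) : Measurable fun ξ : Config N.side N.K =>
      ξ.sum fun u => ENNReal.ofReal (N.deathRate u ξ) * F u (ξ.remove u) := by
  refine Config.measurable_of_tuple fun n => ?_
  simp only [Config.sum_ofTuple]
  refine Finset.measurable_fun_sum _ fun i _ => ?_
  cases n with
  | zero => exact i.elim0
  | succ n =>
    simp only [Config.remove_ofTuple]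
    have h1 : Measurable fun v : Fin (n + 1) → User N.side N.K => i.removeNth v :=
      measurable_pi_lambda _ fun j => measurable_pi_apply (i.succAbove j)
    have h2 : Measurable fun v : Fin (n + 1) → User N.side N.K =>
        (v i, (Config.ofTuple ⟨n, i.removeNth v⟩ : Config N.side N.K)) :=
      (measurable_pi_apply i).prodMk ((Config.measurable_ofTuple n).comp h1)
    exact (N.measurable_deathRate_tuple i).ennreal_ofReal.mul (hF.comp h2)

theorem measurable_totalDeathRate : Measurable N.totalDeathRate := by
  have := N.measurable_config_sum (F := fun _ _ => 1) measurable_const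
  simp only [mul_one] at this
  exact this

theorem measurable_sbdRates (lam : ℝ≥0) : Measurable (N.sbdRates lam) := by
  refine Measure.measurable_of_measurable_coe _ fun B hB => ?_
  have h1 : Measurable (B.indicator (1 : Config N.side N.K → ℝ≥0∞)) := measurable_one.indicator hB
  have h : (fun ξ => N.sbdRates lam ξ B) = fun ξ =>
      lam * ∫⁻ u, B.indicator 1 (ξ.add u) ∂N.arrivalMeasure +
      ξ.sum fun u => ENNReal.ofReal (N.deathRate u ξ) * B.indicator 1 (ξ.remove u) := by
    funext ξ
    rw [← N.kernelOp_sbdRates lam h1, JumpProcess.kernelOp, lintegral_indicator_one hB]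
  rw [h]
  refine Measurable.add (Measurable.const_mul ?_ _)
    (N.measurable_config_sum (F := fun _ ξ => B.indicator 1 ξ) (h1.comp measurable_snd))
  refine Config.measurable_of_tuple fun n => ?_
  simp only [Config.add_ofTuple]
  refine Measurable.lintegral_prod_right' (f := fun z : (Fin n → User N.side N.K) ×
    User N.side N.K => B.indicator (1 : Config N.side N.K → ℝ≥0∞)
      (Config.ofTuple ⟨n + 1, Fin.cons z.2 z.1⟩)) (h1.comp ((Config.measurable_ofTuple _).comp ?_))
  refine measurable_pi_lambda _ fun i => ?_
  refine Fin.cases ?_ (fun j => ?_) i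
  · simpa using measurable_snd
  · simp only [Fin.cons_succ]
    exact (measurable_pi_apply j).comp measurable_fst

theorem totalDeathRate_ne_top (ξ : Config N.side N.K) : N.totalDeathRate ξ ≠ ∞ := by
  obtain ⟨n, v, rfl⟩ := ξ.exists_ofTuple
  rw [totalDeathRate, Config.sum_ofTuple]
  exact ENNReal.sum_ne_top.2 fun i _ => ENNReal.ofReal_ne_top

/-- Arrivals alone bound the total rate below in every state. -/
theorem regularRates {lam : ℝ≥0} (hlam : 0 < lam) :
    JumpProcess.RegularRates (N.sbdRates lam) (lam * N.arrivalMeasure Set.univ) where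
  measurable := N.measurable_sbdRates lam
  ne_top ξ := by
    rw [sbdRates_univ]
    exact ENNReal.add_ne_top.2 ⟨ENNReal.mul_ne_top ENNReal.coe_ne_top
      N.arrivalMeasure_univ_ne_top, N.totalDeathRate_ne_top ξ⟩
  ne_zero := mul_ne_zero (by simpa using hlam.ne') N.arrivalMeasure_univ_ne_zero
  le ξ := by
    rw [sbdRates_univ]
    exact le_self_add

end Network

/-! ## Monotonicity, accessibility of the empty configuration and drift of the number of users -/

namespace Config

variable {a : ℝ} {K : ℕ}

open scoped Classical in
theorem remove_add (ξ : Config a K) (u : User a K) : (ξ.add u).remove u = ξ :=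
  Multiset.erase_cons_head (α := User a K) u ξ

/-- The user `u` is present in the configuration `ξ`. -/
def Present (ξ : Config a K) (u : User a K) : Prop := Membership.mem (γ := Multiset (User a K)) ξ u

/-- Superposition of two configurations. -/
def union (ξ ζ : Config a K) : Config a K :=
  Add.add (α := Multiset (User a K)) ξ ζ

/-- The configuration without users. -/
def empty : Config a K := (0 : Multiset (User a K))

theorem induction {p : Config a K → Prop} (h0 : p empty) (h1 : ∀ ξ u, p ξ → p (ξ.add u))
    (ξ : Config a K) : p ξ :=
  Multiset.induction (α := User a K) (p := p) h0 (fun u s hs => h1 s u hs) ξ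

open scoped Classical in
theorem add_remove {ξ : Config a K} {u : User a K} (h : ξ.Present u) : (ξ.remove u).add u = ξ :=
  Multiset.cons_erase (α := User a K) h

open scoped Classical in
theorem remove_union_left {ξ : Config a K} (ζ : Config a K) {u : User a K} (h : ξ.Present u) :
    (ξ.union ζ).remove u = (ξ.remove u).union ζ :=
  Multiset.erase_add_left_pos (α := User a K) ζ h

open scoped Classical in
theorem remove_union_right (ξ : Config a K) {ζ : Config a K} {u : User a K} (h : ζ.Present u) :
    (ξ.union ζ).remove u = ξ.union (ζ.remove u) :=
  Multiset.erase_add_right_pos (α := User a K) ξ h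

theorem add_union (ξ ζ : Config a K) (u : User a K) :
    (ξ.add u).union ζ = (ξ.union ζ).add u :=
  Multiset.cons_add (α := User a K) u ξ ζ

theorem union_add (ξ ζ : Config a K) (u : User a K) :
    ξ.union (ζ.add u) = (ξ.union ζ).add u :=
  Multiset.add_cons (α := User a K) u ξ ζ

theorem size_remove {ξ : Config a K} {u : User a K} (h : ξ.Present u) :
    (ξ.remove u).size + 1 = ξ.size := by
  rw [← size_add _ u, add_remove h]

theorem size_empty : (empty : Config a K).size = 0 := Multiset.card_zero (α := User a K)

theorem size_union (ξ ζ : Config a K) : (ξ.union ζ).size = ξ.size + ζ.size :=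
  Multiset.card_add (α := User a K) ξ ζ

theorem sum_empty {M : Type*} [AddCommMonoid M] (F : User a K → M) :
    (empty : Config a K).sum F = 0 := by
  rw [Config.sum, empty, Multiset.map_zero, Multiset.sum_zero]

theorem sum_add_user (ξ : Config a K) (u : User a K) {M : Type*} [AddCommMonoid M]
    (F : User a K → M) : (ξ.add u).sum F = F u + ξ.sum F :=
  (congrArg Multiset.sum (Multiset.map_cons F u ξ)).trans (Multiset.sum_cons _ _)

theorem sum_union (ξ ζ : Config a K) {M : Type*} [AddCommMonoid M] (F : User a K → M) :
    (ξ.union ζ).sum F = ξ.sum F + ζ.sum F :=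
  (congrArg Multiset.sum (Multiset.map_add F ξ ζ)).trans (Multiset.sum_add _ _)

theorem sum_mono {ξ : Config a K} {F G : User a K → ℝ≥0∞} (h : ∀ u, ξ.Present u → F u ≤ G u) :
    ξ.sum F ≤ ξ.sum G :=
  Multiset.sum_map_le_sum_map F G h

theorem sum_congr {ξ : Config a K} {F G : User a K → ℝ≥0∞} (h : ∀ u, ξ.Present u → F u = G u) :
    ξ.sum F = ξ.sum G :=
  congrArg Multiset.sum (Multiset.map_congr rfl h)

theorem sum_add (ξ : Config a K) (F G : User a K → ℝ≥0∞) :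
    ξ.sum (fun u => F u + G u) = ξ.sum F + ξ.sum G :=
  Multiset.sum_map_add

theorem sum_mul_const (ξ : Config a K) (F : User a K → ℝ≥0∞) (c : ℝ≥0∞) :
    ξ.sum (fun u => F u * c) = ξ.sum F * c :=
  Multiset.sum_map_mul_right

theorem sum_const (ξ : Config a K) (c : ℝ≥0∞) : ξ.sum (fun _ => c) = ξ.size * c := by
  induction ξ using Config.induction with
  | h0 => rw [sum_empty, size_empty, Nat.cast_zero, zero_mul]
  | h1 ξ u ih =>
    rw [sum_add_user, size_add, ih]
    push_cast
    ring

end Config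

namespace Network

variable (N : Network)

theorem interference_eq (u : User N.side N.K) (ξ : Config N.side N.K) :
    N.interference u ξ = (ξ.remove u).sum (N.pairInterference u) := rfl

theorem sum_pairInterference_nonneg (ξ : Config N.side N.K) (u : User N.side N.K) :
    0 ≤ ξ.sum (N.pairInterference u) := by
  induction ξ using Config.induction with
  | h0 => rw [Config.sum_empty]
  | h1 ξ v ih =>
    rw [Config.sum_add_user]
    exact add_nonneg (N.pairInterference_nonneg u v) ih

theorem interference_nonneg (u : User N.side N.K) (ξ : Config N.side N.K) :
    0 ≤ N.interference u ξ :=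
  N.sum_pairInterference_nonneg (ξ.remove u) u

theorem deathRate_pos (hr : 0 < N.pathLoss N.r) (u : User N.side N.K) (ξ : Config N.side N.K) :
    0 < N.deathRate u ξ := by
  have h1 := N.interference_nonneg u ξ
  have h2 := N.noise_pos
  have h3 : 0 < u.2.2.1.card := Finset.card_pos.2 u.2.2.2
  have h4 := N.L_pos u.2.2
  unfold deathRate rate
  positivity

/-- More users create more interference. This is the monotonicity on which the coupling rests. -/
theorem deathRate_union_le {ξ : Config N.side N.K} (ζ : Config N.side N.K)
    {u : User N.side N.K} (hu : ξ.Present u) : N.deathRate u (ξ.union ζ) ≤ N.deathRate u ξ := by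
  have h1 := N.interference_nonneg u ξ
  have h2 := N.noise_pos
  have h4 := (N.L_pos u.2.2).le
  have h5 := N.pathLoss_nonneg N.r N.r_nonneg
  have h6 : N.interference u ξ ≤ N.interference u (ξ.union ζ) := by
    rw [interference_eq, interference_eq, Config.remove_union_left ζ hu, Config.sum_union]
    exact le_add_of_nonneg_right (N.sum_pairInterference_nonneg ζ u)
  unfold deathRate rate
  gcongr

/-- A bound for all departure rates. -/
def maxDeathRate : ℝ :=
  ∑ C : BandClass N.K, (C.1.card : ℝ) * N.pathLoss N.r / N.noise / N.L C

theorem deathRate_le (u : User N.side N.K) (ξ : Config N.side N.K) :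
    N.deathRate u ξ ≤ N.maxDeathRate := by
  have h1 := N.interference_nonneg u ξ
  have h2 := N.noise_pos
  have h5 := N.pathLoss_nonneg N.r N.r_nonneg
  have h4 : ∀ C, 0 ≤ N.L C := fun C => (N.L_pos C).le
  calc N.deathRate u ξ ≤ (u.2.2.1.card : ℝ) * N.pathLoss N.r / N.noise / N.L u.2.2 := by
        have := h4 u.2.2
        unfold deathRate rate
        gcongr
        linarith
    _ ≤ _ := Finset.single_le_sum
        (f := fun C : BandClass N.K => (C.1.card : ℝ) * N.pathLoss N.r / N.noise / N.L C)
        (fun C _ => by have := h4 C; positivity) (Finset.mem_univ u.2.2)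

theorem sum_deathRate_le (ξ ζ : Config N.side N.K) :
    ξ.sum (fun u => ENNReal.ofReal (N.deathRate u ζ)) ≤
      ξ.size * ENNReal.ofReal N.maxDeathRate := by
  rw [← Config.sum_const]
  exact Config.sum_mono fun u _ => ENNReal.ofReal_le_ofReal (N.deathRate_le u ζ)

/-- The empty configuration is accessible from every configuration. -/
theorem resolvent_empty_ne_zero (hr : 0 < N.pathLoss N.r) {lam : ℝ≥0} (hlam : 0 < lam) (α : ℝ≥0)
    (ξ : Config N.side N.K) :
    JumpProcess.resolvent (N.sbdRates lam) α (({Config.empty} : Set _).indicator 1) ξ ≠ 0 := by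
  have h := N.regularRates hlam
  have h1 := JumpProcess.RegularRates.visits_measurable (Config.empty : Config N.side N.K)
  have hm := h.measurable_resolvent α h1
  induction ξ using Config.induction with
  | h0 =>
    intro h0
    have := h.resolvent_eq α h1 Config.empty
    rw [h0, mul_zero, Set.indicator_of_mem (Set.mem_singleton _)] at this
    exact one_ne_zero (add_eq_zero.1 this.symm).1
  | h1 ξ u ih =>
    intro h0
    have := h.resolvent_eq α h1 (ξ.add u)
    rw [h0, mul_zero, N.kernelOp_sbdRates lam hm] at this
    -- A zero at `ξ.add u` kills every term of the resolvent equation, in particular the one where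
    -- `u` leaves, whose rate is positive.
    have h2 := (add_eq_zero.1 (add_eq_zero.1 this.symm).2).2
    rw [Config.sum_add_user, Config.remove_add] at h2
    have h3 := (mul_eq_zero.1 (add_eq_zero.1 h2).1).resolve_right ih
    exact absurd (ENNReal.ofReal_eq_zero.1 h3) (not_le.2 (N.deathRate_pos hr u _))

/-- Drift of the number of users. -/
theorem drift_size (lam : ℝ≥0) (ξ : Config N.side N.K) :
    JumpProcess.kernelOp (N.sbdRates lam) (fun ξ => (ξ.size : ℝ≥0∞)) ξ + N.totalDeathRate ξ ≤
      N.sbdRates lam ξ Set.univ * ξ.size + lam * N.arrivalMeasure Set.univ := by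
  have hm : Measurable fun ξ : Config N.side N.K => (ξ.size : ℝ≥0∞) :=
    (measurable_of_countable fun n : ℕ => (n : ℝ≥0∞)).comp Config.measurable_size
  rw [N.kernelOp_sbdRates lam hm, sbdRates_univ, totalDeathRate, add_assoc, ← Config.sum_add ξ]
  have h1 : ξ.sum (fun u => ENNReal.ofReal (N.deathRate u ξ) * ((ξ.remove u).size : ℝ≥0∞) +
      ENNReal.ofReal (N.deathRate u ξ)) =
      ξ.sum (fun u => ENNReal.ofReal (N.deathRate u ξ)) * ξ.size := by
    rw [← Config.sum_mul_const ξ]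
    refine Config.sum_congr fun u hu => ?_
    rw [← Config.size_remove hu]
    push_cast
    rw [mul_add, mul_one]
  rw [h1]
  simp only [Config.size_add, lintegral_const]
  push_cast
  refine le_of_eq ?_
  ring

/-- The process is a pure birth process: each number of users is held for one exponential time and
never seen again. -/
theorem transient_of_pathLoss_eq_zero (hr : N.pathLoss N.r = 0) {lam : ℝ≥0} (hlam : 0 < lam) :
    JumpProcess.Transient (N.sbdRates lam) := by
  have h := N.regularRates hlam
  set q₀ := lam * N.arrivalMeasure Set.univ with hq₀
  have hd : ∀ u ξ, N.deathRate u ξ = 0 := fun u ξ => by simp [deathRate, rate, hr]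
  have hq0t : q₀ ≠ ∞ := ENNReal.mul_ne_top ENNReal.coe_ne_top N.arrivalMeasure_univ_ne_top
  have hq : ∀ ξ, N.sbdRates lam ξ Set.univ = q₀ := fun ξ => by
    rw [sbdRates_univ, totalDeathRate]
    simp [hd, Config.sum_const, hq₀]
  have hA : ∀ i : ℕ, MeasurableSet {ξ : Config N.side N.K | ξ.size = i} := fun i =>
    Config.measurable_size (measurableSet_singleton i)
  refine ⟨fun i => {ξ | ξ.size = i}, hA, Set.eq_univ_of_forall fun ξ => by simp, fun i => ?_⟩
  refine ⟨(q₀⁻¹).toNNReal, fun ξ _ => ?_⟩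
  rw [ENNReal.coe_toNNReal (ENNReal.inv_ne_top.2 h.ne_zero), h.potential_eq (hA i)]
  -- The exact expected time at size `i`: one mean holding time if this size is still to be passed,
  -- nothing otherwise.
  let g : Config N.side N.K → ℝ≥0∞ := fun ξ => if ξ.size ≤ i then q₀⁻¹ else 0
  have hg : Measurable g := Measurable.ite
    (Config.measurable_size (measurableSet_Iic (a := i))) measurable_const measurable_const
  refine (JumpProcess.greenOp_le (g := g) (h.measurable_killedStep 0)
    (h.measurable_inv_mul 0 (measurable_one.indicator (hA i))) (fun η => ?_) ξ).trans ?_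
  · rw [JumpProcess.RegularRates.kernelOp_killedStep, N.kernelOp_sbdRates lam hg, hq, ENNReal.coe_zero, zero_add,
      ← mul_add]
    have h0 : (η.sum fun u => ENNReal.ofReal (N.deathRate u η) * g (η.remove u)) = 0 := by
      simp [hd, Config.sum_const]
    rw [h0, add_zero]
    simp only [g, Config.size_add]
    rcases lt_trichotomy η.size i with hi | hi | hi
    · have h3 : η.size + 1 ≤ i := hi
      have h4 : η ∉ {ξ : Config N.side N.K | ξ.size = i} := hi.ne
      rw [Set.indicator_of_notMem h4, if_pos h3, if_pos hi.le, lintegral_const, zero_add,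
        mul_comm q₀⁻¹ (N.arrivalMeasure Set.univ), ← mul_assoc (lam : ℝ≥0∞), ← hq₀, ← mul_assoc,
        ENNReal.inv_mul_cancel h.ne_zero hq0t, one_mul]
    · have h4 : η ∈ {ξ : Config N.side N.K | ξ.size = i} := hi
      rw [Set.indicator_of_mem h4, if_neg (by omega), if_pos hi.le]
      simp
    · have h4 : η ∉ {ξ : Config N.side N.K | ξ.size = i} := hi.ne'
      rw [Set.indicator_of_notMem h4, if_neg (by omega), if_neg (by omega)]
      simp
  · simp only [g]
    split_ifs
    · exact le_rfl
    · exact zero_le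

end Network

/-! ## Comparison of processes with ordered arrival intensities -/

namespace Network

variable (N : Network)

/-- Rate at which a pair of coupled configurations `ξ` and `ξ.union ζ` jumps. -/
def coupledRate (lam : ℝ≥0) (ξ ζ : Config N.side N.K) : ℝ≥0∞ :=
  lam * N.arrivalMeasure Set.univ + N.totalDeathRate ξ +
    ζ.sum fun u => ENNReal.ofReal (N.deathRate u (ξ.union ζ))

theorem coupledRate_le (lam : ℝ≥0) (ξ ζ : Config N.side N.K) :
    N.coupledRate lam ξ ζ ≤ lam * N.arrivalMeasure Set.univ +
      (ξ.union ζ).size * ENNReal.ofReal N.maxDeathRate := by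
  rw [coupledRate, add_assoc, Config.size_union, Nat.cast_add, add_mul]
  gcongr
  · exact N.sum_deathRate_le ξ ξ
  · exact N.sum_deathRate_le ζ _

variable {N} {lam δ α : ℝ≥0} {f f' g g' : Config N.side N.K → ℝ≥0∞}

/-- One step of the coupling of the processes of intensities `lam` and `lam + δ`. -/
theorem coupling_step {M ε S : ℝ≥0∞} (hg : Measurable g) (hg' : Measurable g')
    (hM : ((lam + δ : ℝ≥0) : ℝ≥0∞) * N.arrivalMeasure Set.univ ≤ α * M)
    (hsub : ∀ η, ((α : ℝ≥0∞) + N.sbdRates (lam + δ) η Set.univ) * g η ≤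
      f η + JumpProcess.kernelOp (N.sbdRates (lam + δ)) g η)
    (hsup : ∀ ξ, f' ξ + JumpProcess.kernelOp (N.sbdRates lam) g' ξ ≤
      ((α : ℝ≥0∞) + N.sbdRates lam ξ Set.univ) * g' ξ)
    (hf : ∀ ξ ζ, f (ξ.union ζ) ≤ f' ξ)
    (hS : ∀ ξ ζ, g (ξ.union ζ) ≤ g' ξ + ε * (M + (ξ.union ζ).size) + S)
    (ξ ζ : Config N.side N.K) :
    ((α : ℝ≥0∞) + N.coupledRate (lam + δ) ξ ζ) * g (ξ.union ζ) ≤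
      ((α : ℝ≥0∞) + N.coupledRate (lam + δ) ξ ζ) * (g' ξ + ε * (M + (ξ.union ζ).size)) +
        N.coupledRate (lam + δ) ξ ζ * S := by
  set η := ξ.union ζ with hη
  set b := N.arrivalMeasure Set.univ with hb
  set W := ε * (M + η.size) with hW
  let d : User N.side N.K → Config N.side N.K → ℝ≥0∞ := fun u ξ => ENNReal.ofReal (N.deathRate u ξ)
  -- The excess rate at which `u` leaves the small configuration while staying in the large one.
  let e : User N.side N.K → ℝ≥0∞ := fun u => d u ξ - d u η
  have hde : ∀ u, ξ.Present u → d u η + e u = d u ξ := fun u hu =>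
    add_tsub_cancel_of_le (ENNReal.ofReal_le_ofReal (N.deathRate_union_le ζ hu))
  have hDξ : ξ.sum (fun u => d u η) + ξ.sum e = ξ.sum fun u => d u ξ := by
    rw [← Config.sum_add]
    exact Config.sum_congr hde
  have hW1 : ∀ u, ε * (M + (η.add u).size) = W + ε := fun u => by
    rw [Config.size_add, hW]
    push_cast
    ring
  have hWle : ∀ ξ' : Config N.side N.K, ξ'.size ≤ η.size → ε * (M + ξ'.size) ≤ W := fun ξ' h => by
    rw [hW]
    gcongr
  -- arrivals
  have hbirth1 : ∫⁻ u, g (η.add u) ∂N.arrivalMeasure ≤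
      ∫⁻ u, g' (ξ.add u) ∂N.arrivalMeasure + b * (W + ε + S) := by
    have h1 : ∀ u, g (η.add u) ≤ g' (ξ.add u) + (W + ε + S) := fun u => by
      have := hS (ξ.add u) ζ
      rw [Config.add_union, ← hη, hW1] at this
      exact this.trans_eq (by ring)
    refine (lintegral_mono h1).trans_eq ?_
    rw [lintegral_add_right _ measurable_const, lintegral_const, mul_comm b]
  -- Arrivals of the additional intensity `δ` join only the large configuration, that is `ζ`.
  have hbirth2 : ∫⁻ u, g (η.add u) ∂N.arrivalMeasure ≤ b * (g' ξ + W + ε + S) := by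
    have h1 : ∀ u, g (η.add u) ≤ g' ξ + W + ε + S := fun u => by
      have := hS ξ (ζ.add u)
      rw [Config.union_add, ← hη, hW1] at this
      exact this.trans_eq (by ring)
    refine (lintegral_mono h1).trans_eq ?_
    rw [lintegral_const, mul_comm b]
  -- departures of users of the small configuration
  have hdeath1 : ∀ u, ξ.Present u → g (η.remove u) ≤ g' (ξ.remove u) + (W + S) := fun u hu => by
    have h1 := hS (ξ.remove u) ζ
    rw [← Config.remove_union_left ζ hu, ← hη] at h1
    have h2 : (η.remove u).size ≤ η.size := by
      rw [hη, Config.remove_union_left ζ hu, Config.size_union, Config.size_union,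
        ← Config.size_remove hu]
      omega
    calc _ ≤ _ := h1
      _ ≤ g' (ξ.remove u) + W + S := by
        gcongr
        exact hWle _ h2
      _ = _ := by ring
  -- A user leaving only the small configuration moves from `ξ` to `ζ`, and the union does not
  -- change.
  have hdeath2 : ∀ u, ξ.Present u → g η ≤ g' (ξ.remove u) + (W + S) := fun u hu => by
    have h1 := hS (ξ.remove u) (ζ.add u)
    rw [Config.union_add, ← Config.add_union, Config.add_remove hu, ← hη] at h1
    exact h1.trans_eq (by ring)
  have hdeathξ : ξ.sum (fun u => d u η * g (η.remove u)) + ξ.sum e * g η ≤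
      ξ.sum (fun u => d u ξ * g' (ξ.remove u)) + (ξ.sum fun u => d u ξ) * (W + S) := by
    rw [← Config.sum_mul_const, ← Config.sum_mul_const, ← Config.sum_add, ← Config.sum_add]
    refine Config.sum_mono fun u hu => ?_
    rw [← mul_add, ← hde u hu, add_mul]
    exact add_le_add (mul_le_mul_right (hdeath1 u hu) _) (mul_le_mul_right (hdeath2 u hu) _)
  -- departures of the other users
  have hdeathζ : ζ.sum (fun u => d u η * g (η.remove u)) ≤
      (ζ.sum fun u => d u η) * (g' ξ + W + S) := by
    rw [← Config.sum_mul_const]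
    refine Config.sum_mono fun u hu => mul_le_mul_right ?_ _
    have h1 := hS ξ (ζ.remove u)
    rw [← Config.remove_union_right ξ hu, ← hη] at h1
    have h2 : (η.remove u).size ≤ η.size := by
      rw [hη, Config.remove_union_right ξ hu, Config.size_union, Config.size_union,
        ← Config.size_remove hu]
      omega
    refine h1.trans ?_
    gcongr
    exact hWle _ h2
  have hsub' := hsub η
  have hsup' := hsup ξ
  rw [sbdRates_univ, N.kernelOp_sbdRates _ hg, totalDeathRate, hη, Config.sum_union,
    Config.sum_union, ← hη] at hsub'
  rw [sbdRates_univ, N.kernelOp_sbdRates _ hg', totalDeathRate] at hsup'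
  rw [coupledRate, totalDeathRate, ← hη]
  set Dξ := ξ.sum fun u => d u ξ
  set Dη := ξ.sum fun u => d u η
  set E := ξ.sum e
  set Dζ := ζ.sum fun u => d u η
  set Gξ := ξ.sum fun u => d u η * g (η.remove u)
  set Gζ := ζ.sum fun u => d u η * g (η.remove u)
  set Gξ' := ξ.sum fun u => d u ξ * g' (ξ.remove u)
  set I := ∫⁻ u, g (η.add u) ∂N.arrivalMeasure
  set I' := ∫⁻ u, g' (ξ.add u) ∂N.arrivalMeasure
  change ((α : ℝ≥0∞) + (((lam + δ : ℝ≥0) : ℝ≥0∞) * b + (Dη + Dζ))) * g η ≤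
    f η + (((lam + δ : ℝ≥0) : ℝ≥0∞) * I + (Gξ + Gζ)) at hsub'
  change f' ξ + (lam * I' + Gξ') ≤ ((α : ℝ≥0∞) + (lam * b + Dξ)) * g' ξ at hsup'
  change ((α : ℝ≥0∞) + (((lam + δ : ℝ≥0) : ℝ≥0∞) * b + Dξ + Dζ)) * g η ≤
    ((α : ℝ≥0∞) + (((lam + δ : ℝ≥0) : ℝ≥0∞) * b + Dξ + Dζ)) * (g' ξ + W) +
      (((lam + δ : ℝ≥0) : ℝ≥0∞) * b + Dξ + Dζ) * S
  -- The penalty grows through arrivals at rate at most (λ + δ) b ε, and discounting at rate α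
  -- absorbs this.
  have hMW : ((lam + δ : ℝ≥0) : ℝ≥0∞) * b * ε ≤ α * W := by
    calc _ ≤ α * M * ε := by gcongr
      _ ≤ α * (M + η.size) * ε := by gcongr; exact le_self_add
      _ = _ := by rw [hW]; ring
  push_cast at hsub' hMW ⊢
  -- Adding `E * g η` gives the large process jumps to its own state at the excess rate, so that its
  -- total rate becomes that of the coupled pair.
  calc _ = ((α : ℝ≥0∞) + ((lam + δ) * b + (Dη + Dζ))) * g η + E * g η := by rw [← hDξ]; ring
    _ ≤ (f η + ((lam + δ) * I + (Gξ + Gζ))) + E * g η := by gcongr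
    _ = f η + (lam * I + δ * I) + (Gξ + E * g η) + Gζ := by ring
    _ ≤ f' ξ + (lam * (I' + b * (W + ε + S)) + δ * (b * (g' ξ + W + ε + S))) +
        (Gξ' + Dξ * (W + S)) + Dζ * (g' ξ + W + S) := by
      gcongr
      exact hf ξ ζ
    _ = (f' ξ + (lam * I' + Gξ')) + (lam + δ) * b * ε + δ * b * g' ξ + Dζ * g' ξ +
        ((lam + δ) * b + Dξ + Dζ) * W + ((lam + δ) * b + Dξ + Dζ) * S := by ring
    _ ≤ ((α : ℝ≥0∞) + (lam * b + Dξ)) * g' ξ + α * W + δ * b * g' ξ + Dζ * g' ξ +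
        ((lam + δ) * b + Dξ + Dζ) * W + ((lam + δ) * b + Dξ + Dζ) * S := by gcongr
    _ = _ := by ring

/-- Comparison principle: bounded subsolutions for the larger intensity are dominated, along
enlargements of configurations, by supersolutions for the smaller one. -/
theorem comparison (hα : 0 < α) {C : ℝ≥0∞} (hC : C ≠ ∞) (hg : Measurable g) (hg' : Measurable g')
    (hgC : ∀ η, g η ≤ C)
    (hsub : ∀ η, ((α : ℝ≥0∞) + N.sbdRates (lam + δ) η Set.univ) * g η ≤
      f η + JumpProcess.kernelOp (N.sbdRates (lam + δ)) g η)
    (hsup : ∀ ξ, f' ξ + JumpProcess.kernelOp (N.sbdRates lam) g' ξ ≤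
      ((α : ℝ≥0∞) + N.sbdRates lam ξ Set.univ) * g' ξ)
    (hf : ∀ ξ ζ, f (ξ.union ζ) ≤ f' ξ) (ξ ζ : Config N.side N.K) : g (ξ.union ζ) ≤ g' ξ := by
  have hα0 : (α : ℝ≥0∞) ≠ 0 := by simpa using hα.ne'
  set B : ℝ≥0∞ := ((lam + δ : ℝ≥0) : ℝ≥0∞) * N.arrivalMeasure Set.univ
  have hB : B ≠ ∞ := ENNReal.mul_ne_top ENNReal.coe_ne_top N.arrivalMeasure_univ_ne_top
  -- The shift that makes `ε * (M + size)` a supersolution, the drift of the size being at most `B`.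
  set M : ℝ≥0∞ := B / α
  have hMt : M ≠ ∞ := ENNReal.div_ne_top hB hα0
  have hM : B ≤ α * M := (ENNReal.mul_div_cancel hα0 ENNReal.coe_ne_top).ge
  suffices h : ∀ ε : ℝ≥0, 0 < ε → g (ξ.union ζ) ≤ g' ξ + ε * (M + (ξ.union ζ).size) by
    refine ENNReal.le_of_forall_pos_le_add fun ε hε _ => ?_
    have hne : M + (ξ.union ζ).size ≠ ∞ := ENNReal.add_ne_top.2 ⟨hMt, ENNReal.natCast_ne_top _⟩
    obtain ⟨ε', hε', hlt⟩ := ENNReal.exists_nnreal_pos_mul_lt hne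
      (show (ε : ℝ≥0∞) ≠ 0 by simpa using hε.ne')
    exact (h ε' hε').trans (add_le_add_right hlt.le _)
  intro ε hε
  have hε0 : (ε : ℝ≥0∞) ≠ 0 := by simpa using hε.ne'
  -- The truncated difference is the violation of the penalized inequality; the penalty confines it
  -- to configurations of bounded size.
  let F : Config N.side N.K → Config N.side N.K → ℝ≥0∞ := fun ξ ζ =>
    g (ξ.union ζ) - (g' ξ + ε * (M + (ξ.union ζ).size))
  set S : ℝ≥0∞ := ⨆ ξ, ⨆ ζ, F ξ ζ with hSdef
  have hFS : ∀ ξ ζ, F ξ ζ ≤ S := fun ξ ζ => le_iSup_of_le ξ (le_iSup (F ξ) ζ)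
  have hSt : S ≠ ∞ := ne_top_of_le_ne_top hC
    (iSup_le fun ξ => iSup_le fun ζ => tsub_le_self.trans (hgC _))
  have hstep := coupling_step (N := N) (S := S) hg hg' hM hsub hsup hf
    (fun ξ ζ => tsub_le_iff_left.1 (hFS ξ ζ))
  obtain ⟨n, hn⟩ : ∃ n : ℕ, C < n * ε := by
    obtain ⟨n, hn⟩ := ENNReal.exists_nat_gt (ENNReal.div_ne_top hC hε0)
    exact ⟨n, (ENNReal.div_lt_iff (Or.inl hε0) (Or.inl ENNReal.coe_ne_top)).1 hn⟩
  set R : ℝ≥0∞ := B + n * ENNReal.ofReal N.maxDeathRate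
  have hR : R ≠ ∞ := ENNReal.add_ne_top.2
    ⟨hB, ENNReal.mul_ne_top (ENNReal.natCast_ne_top n) ENNReal.ofReal_ne_top⟩
  have hαR0 : (α : ℝ≥0∞) + R ≠ 0 := by simp [hα.ne']
  have hαRt : (α : ℝ≥0∞) + R ≠ ∞ := ENNReal.add_ne_top.2 ⟨ENNReal.coe_ne_top, hR⟩
  -- Beyond size `n` the penalty exceeds the bound `C` on `g`. Below it the coupled rate q is at
  -- most `R`, so the factor q/(α + q) from one coupled step is uniformly less than 1. A finite
  -- supremum contracted in this way is 0.
  have hbound : ∀ ξ ζ, F ξ ζ ≤ R / (α + R) * S := fun ξ ζ => by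
    rcases le_total n (ξ.union ζ).size with hle | hle
    · have h0 : F ξ ζ = 0 := by
        refine tsub_eq_zero_of_le ((hgC _).trans (hn.le.trans ?_))
        calc (n : ℝ≥0∞) * ε ≤ ε * (M + (ξ.union ζ).size) := by
              rw [mul_comm]
              gcongr
              exact le_add_left (by exact_mod_cast hle)
          _ ≤ _ := le_add_self
      rw [h0]
      exact zero_le
    · set q := N.coupledRate (lam + δ) ξ ζ
      have hq : q ≤ R := (N.coupledRate_le _ ξ ζ).trans
        (add_le_add_right (mul_le_mul_left (Nat.cast_le.2 hle) _) _)
      have hqt : (α : ℝ≥0∞) + q ≠ ∞ :=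
        ENNReal.add_ne_top.2 ⟨ENNReal.coe_ne_top, ne_top_of_le_ne_top hR hq⟩
      have hq0 : (α : ℝ≥0∞) + q ≠ 0 := by simp [hα.ne']
      refine tsub_le_iff_left.2 ?_
      refine (ENNReal.mul_le_mul_iff_right hq0 hqt).1 ((hstep ξ ζ).trans ?_)
      rw [mul_add _ _ (R / (α + R) * S), ← mul_assoc _ _ S]
      refine add_le_add_right (mul_le_mul_left ?_ S) _
      rw [← mul_div_assoc, ENNReal.le_div_iff_mul_le (Or.inl hαR0) (Or.inl hαRt), mul_add, add_mul]
      refine add_le_add ?_ le_rfl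
      rw [mul_comm]
      gcongr
  have hS0 : S = 0 := by
    by_contra hne
    have h1 : S ≤ R / (α + R) * S := iSup_le fun ξ => iSup_le fun ζ => hbound ξ ζ
    have h2 : R / (α + R) < 1 := by
      rw [ENNReal.div_lt_iff (Or.inl hαR0) (Or.inl hαRt), one_mul, add_comm]
      exact ENNReal.lt_add_right hR hα0
    have h3 : R / (α + R) * S < 1 * S := ENNReal.mul_lt_mul_left hne hSt h2
    rw [one_mul] at h3
    exact absurd h1 (not_le.2 h3)
  have := hFS ξ ζ
  rw [hS0, nonpos_iff_eq_zero, tsub_eq_zero_iff_le] at this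
  exact this

end Network

/-! ## Stability is monotone in the arrival intensity -/

namespace Config

variable {a : ℝ} {K : ℕ}

theorem empty_union (ξ : Config a K) : empty.union ξ = ξ := zero_add (M := Multiset (User a K)) ξ

theorem eq_empty_of_union {ξ ζ : Config a K} (h : ξ.union ζ = empty) : ξ = empty := by
  have h1 := size_union ξ ζ
  rw [h, size_empty] at h1
  exact Multiset.card_eq_zero (α := User a K).1 (Nat.add_eq_zero_iff.1 h1.symm).1

end Config

namespace Network

variable (N : Network)

/-- The mass of the empty configuration under the invariant law for the larger intensity bounds from
below the discounted occupation of that configuration for the smaller one, which is the input of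
`positiveRecurrent_of_atom`. -/
theorem stable_of_add {lam δ : ℝ≥0} (hlam : 0 < lam) (h : N.Stable (lam + δ)) : N.Stable lam := by
  have hlamδ : 0 < lam + δ := add_pos_of_pos_of_nonneg hlam zero_le
  rcases (N.pathLoss_nonneg N.r N.r_nonneg).eq_or_lt with hr | hr
  · exact absurd h.1 (N.transient_of_pathLoss_eq_zero hr.symm hlamδ).not_recurrent
  obtain ⟨π, hπ⟩ := h.2
  have := hπ.1
  have hR := N.regularRates hlam
  have hR' := N.regularRates hlamδ
  have ho := measurableSet_singleton (Config.empty : Config N.side N.K)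
  have h1 := JumpProcess.RegularRates.visits_measurable (Config.empty : Config N.side N.K)
  have hle1 : ∀ ξ : Config N.side N.K,
      ({Config.empty} : Set (Config N.side N.K)).indicator (1 : Config N.side N.K → ℝ≥0∞) ξ ≤ 1 :=
    fun ξ => Set.indicator_le_self' (fun _ _ => zero_le) ξ
  have hinv := fun (α : ℝ≥0) (hα : 0 < α) => hR'.invariant_resolvent hπ ho hα
  have hc0 : π {Config.empty} ≠ 0 := by
    rw [← hinv 1 one_pos, ENNReal.coe_one, one_mul]
    intro h0
    rw [lintegral_eq_zero_iff (hR'.measurable_resolvent 1 h1)] at h0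
    obtain ⟨ξ, hξ⟩ := h0.exists
    exact N.resolvent_empty_ne_zero hr hlamδ 1 ξ hξ
  refine hR.positiveRecurrent_of_atom (N.resolvent_empty_ne_zero hr hlam 0) hc0 (fun α hα => ?_)
    (V := fun ξ => (ξ.size : ℝ≥0∞))
    ((measurable_of_countable fun n : ℕ => (n : ℝ≥0∞)).comp Config.measurable_size)
    N.measurable_totalDeathRate (ENNReal.natCast_ne_top _)
    (ENNReal.mul_ne_top ENNReal.coe_ne_top N.arrivalMeasure_univ_ne_top)
    (N.drift_size lam) (N.sbdRates_univ lam)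
  rw [← hinv α hα]
  refine mul_le_mul_right ?_ _
  have hα0 : (α : ℝ≥0∞) ≠ 0 := by simpa using hα.ne'
  -- The small process starts empty inside an arbitrary `ξ`; whenever the large one is empty, so is
  -- the small one.
  have hcomp : ∀ ξ, JumpProcess.resolvent (N.sbdRates (lam + δ)) α
      (({Config.empty} : Set _).indicator 1) ξ ≤ JumpProcess.resolvent (N.sbdRates lam) α
      (({Config.empty} : Set _).indicator 1) Config.empty := fun ξ => by
    have := comparison (N := N) hα (ENNReal.inv_ne_top.2 hα0) (hR'.measurable_resolvent α h1)
      (hR.measurable_resolvent α h1) (hR'.resolvent_le hα h1 hle1)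
      (fun η => (hR'.resolvent_eq α h1 η).le) (fun η => (hR.resolvent_eq α h1 η).ge)
      (fun ξ ζ => ?_) Config.empty ξ
    · rwa [Config.empty_union] at this
    · by_cases hu : ξ.union ζ = Config.empty
      · rw [Config.eq_empty_of_union hu, Set.indicator_of_mem (Set.mem_singleton _)]
        exact hle1 _
      · rw [Set.indicator_of_notMem (by exact hu)]
        exact zero_le
  refine (lintegral_mono hcomp).trans ?_
  rw [lintegral_const, measure_univ, mul_one]

theorem stable_of_le {lam lam' : ℝ≥0} (hlam : 0 < lam) (hle : lam ≤ lam') (h : N.Stable lam') :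
    N.Stable lam := by
  rw [← add_tsub_cancel_of_le hle] at h
  exact N.stable_of_add hlam h

theorem Stable.not_unstable {N : Network} {lam : ℝ≥0} (h : N.Stable lam) : ¬ N.Unstable lam := by
  rintro (hn | ht)
  · exact hn.2 h.2
  · exact ht.not_recurrent h.1

/-- The potential of the empty configuration from itself is finite or infinite; in the second case,
an invariant probability exists or not. -/
theorem stable_or_unstable {lam : ℝ≥0} (hlam : 0 < lam) : N.Stable lam ∨ N.Unstable lam := by
  rcases (N.pathLoss_nonneg N.r N.r_nonneg).eq_or_lt with hr | hr
  · exact Or.inr (Or.inr (N.transient_of_pathLoss_eq_zero hr.symm hlam))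
  have h := N.regularRates hlam
  have hacc := N.resolvent_empty_ne_zero hr hlam 0
  by_cases htop : JumpProcess.resolvent (N.sbdRates lam) 0
      (({Config.empty} : Set _).indicator 1) Config.empty = ∞
  · have hrec := h.recurrent_of_atom hacc htop
    by_cases hπ : ∃ π, JumpProcess.IsInvariantProb (N.sbdRates lam) π
    · exact Or.inl ⟨hrec, hπ⟩
    · exact Or.inr (Or.inl ⟨hrec, hπ⟩)
  · exact Or.inr (Or.inr (h.transient_of_atom hacc htop))

end Network

end

/-! ### The critical intensities. -/

theorem mainTheorem8 (N : Network) :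
    ∃ lamMinus lamPlus : ℝ≥0∞,
      IsLUB ((fun lam : ℝ≥0 => (lam : ℝ≥0∞)) '' {lam | 0 < lam ∧ N.Stable lam}) lamMinus ∧
      IsGLB ((fun lam : ℝ≥0 => (lam : ℝ≥0∞)) '' {lam | 0 < lam ∧ N.Unstable lam}) lamPlus ∧
      0 ≤ lamMinus ∧ lamMinus ≤ lamPlus ∧
      (∀ lam : ℝ≥0, 0 < lam → (lam : ℝ≥0∞) < lamMinus → N.Stable lam) ∧
      (∀ lam : ℝ≥0, 0 < lam → lamPlus < (lam : ℝ≥0∞) → N.Unstable lam) := by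
  -- In `ℝ≥0∞` the empty set has supremum 0 and infimum ∞, as the conventions of the theorem
  -- require.
  refine ⟨_, _, isLUB_sSup _, isGLB_sInf _, zero_le, ?_, fun lam hlam h => ?_,
    fun lam hlam h => ?_⟩
  · refine sSup_le ?_
    rintro _ ⟨lam, ⟨_, hs⟩, rfl⟩
    refine le_sInf ?_
    rintro _ ⟨lam', ⟨hlam', hu⟩, rfl⟩
    refine ENNReal.coe_le_coe.2 (le_of_not_gt fun hlt => ?_)
    exact (N.stable_of_le hlam' hlt.le hs).not_unstable hu
  · obtain ⟨_, ⟨lam', ⟨_, hs⟩, rfl⟩, hlt⟩ := lt_sSup_iff.1 h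
    exact N.stable_of_le hlam (ENNReal.coe_lt_coe.1 hlt).le hs
  · obtain ⟨_, ⟨lam', ⟨hlam', hu⟩, rfl⟩, hlt⟩ := sInf_lt_iff.1 h
    refine (N.stable_or_unstable hlam).resolve_left fun hs => ?_
    exact (N.stable_of_le hlam' (ENNReal.coe_lt_coe.1 hlt).le hs).not_unstable hu
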